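/- Theorem 4.1. Let $0<\alpha<1$, $r>0$ and $C_1,C_2\in\mathbb{R}$. For $f$ locally absolutely continuous on $[0,\infty)$ let $$D^\alpha f(t)=\frac1{\Gamma(1-\alpha)}\int_0^t (t-\tau)^{-\alpha}f'(\tau)\,d\tau$$ be its Caputo derivative (defined for almost every $t>0$), and let $E_\alpha(z)=\sum_{k\ge 0} z^k/\Gamma(\alpha k+1)$ be the Mittag-Leffler function. Let $A=\begin{pmatrix} a&b\\-b&a\end{pmatrix}$ be a real $2\times 2$ matrix in canonical form whose set of eigenvalues is $\{re^{i\alpha\pi/2},\,re^{-i\alpha\pi/2}\}$. A solution of $$D^\alpha X(t)=AX(t),\qquad X(0)=(C_1,C_2),$$ is a function $X=(x,y)$ with locally absolutely continuous components on $[0,\infty)$ that satisfies the initial condition, and the equation for almost every $t>0$. Then a solution exists, and one that satisfies the equation for every $t>0$. Every solution satisfies $$x(t)^2+y(t)^2=(C_1^2+C_2^2)\,\bigl|E_\alpha(re^{i\alpha\pi/2}t^\alpha)\bigr|^2\qquad(t\ge 0),$$ $$\lim_{t\to\infty}\bigl(x(t)^2+y(t)^2\bigr)=\frac{C_1^2+C_2^2}{\alpha^2},$$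 and the distance from $X(t)$ to the circle of radius $\sqrt{C_1^2+C_2^2}/\alpha$ centred at the origin tends to $0$ as $t\to\infty$. -/

import Mathlib

open MeasureTheory Filter Topology

noncomputable section

/-- The one-parameter Mittag-Leffler function `E_α(z) = ∑ z ^ k / Γ(α k + 1)`, for `α > 0`. -/
def mittagLeffler (α : ℝ) (z : ℂ) : ℂ :=
  ∑' k : ℕ, z ^ k / (Real.Gamma (α * k + 1) : ℂ)

/-- The Caputo derivative of order `α ∈ (0, 1)` with base point `0`:
`(1 / Γ(1 - α)) ∫₀ᵗ (t - τ) ^ (-α) f'(τ) dτ`. -/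
def caputoDeriv (α : ℝ) (f : ℝ → ℝ) (t : ℝ) : ℝ :=
  1 / Real.Gamma (1 - α) * ∫ τ in (0 : ℝ)..t, (t - τ) ^ (-α) * deriv f τ

/-- `X` solves the initial value problem `D^α X = A X` on `[0, ∞)`, `X(0) = X₀`, where `D^α` is
the Caputo derivative of order `α ∈ (0, 1)`. Solutions are locally absolutely continuous, which is
the class on which the Caputo derivative is defined almost everywhere, and the equation
holds at almost every `t > 0`. -/
structure IsCaputoSolution {n : ℕ} (α : ℝ) (A : Matrix (Fin n) (Fin n) ℝ)
    (X₀ : EuclideanSpace ℝ (Fin n)) (X : ℝ → EuclideanSpace ℝ (Fin n)) : Prop where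
  init : X 0 = X₀
  absCont : ∀ i, ∀ T : ℝ, 0 < T → AbsolutelyContinuousOnInterval (fun s => X s i) 0 T
  equation : ∀ i, ∀ᵐ t ∂(volume.restrict (Set.Ioi (0 : ℝ))),
    caputoDeriv α (fun s => X s i) t = A.mulVec (fun j => X t j) i

end

/-! ### Growth of the Gamma function and the Mittag-Leffler series -/

/-! Identify `(x, y)` with `x + iy`. Then `A` acts as multiplication by `l = a - ib`, and the
solution is `(C₁ + iC₂) E_α(l t^α)`. The Caputo derivative shifts the coefficients of a series in
`t^α` (`caputoDeriv_fracSeries`), which gives existence. The Riemann-Liouville integral turns the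
equation into a Volterra equation with kernel `(t - s)^(α - 1)`, and a weakly singular Gronwall
argument gives uniqueness (`IsCaputoSolution.eq_of_planar`). Since `l` is one of the two conjugate
eigenvalues and `E_α` commutes with conjugation, taking moduli gives the identity for `x² + y²`.

For the limit, scaling time by `r^(1/α)` reduces to `E_α(I^α t^α)`, whose Laplace transform is
`p^(α-1) / (p^α - I^α)`. In the closed right half-plane its only pole is `p = I`, with residue
`1/α`, and it has an integrable singularity `|p|^(α-1)` at `0`. Subtracting `(1/α)/(p - I)` removes
the pole. Subtracting also `(1 - 1/α)/(p + 1)` cancels the `1/p` behaviour at infinity and leaves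
decay `|p|^(-1-α)`. The resulting `laplaceKernel` is integrable on the imaginary axis, so the
inversion contour can be moved there (`integral_laplaceKernel_imaginary_axis`), and the
Riemann-Lebesgue lemma sends the remainder to `0`. What survives is `(1/α) e^{it}`, of constant
modulus `1/α`. -/

theorem rpow_mul_exp_neg_le_Gamma {x R : ℝ} (hx : 0 ≤ x) (hR : 0 ≤ R) :
    R ^ x * Real.exp (-R) ≤ Real.Gamma (x + 1) := by
  have hint : IntegrableOn (fun t : ℝ => Real.exp (-t) * t ^ (x + 1 - 1)) (Set.Ioi 0) :=
    Real.GammaIntegral_convergent (by linarith)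
  have hsub : Set.Ioi R ⊆ Set.Ioi (0 : ℝ) := Set.Ioi_subset_Ioi hR
  rw [Real.Gamma_eq_integral (by linarith), ← integral_exp_neg_Ioi R, ← integral_const_mul]
  -- Only the part of the Gamma integral over `(R, ∞)` is kept; there `t ^ x ≥ R ^ x`.
  refine le_trans ?_ (setIntegral_mono_set hint ?_ hsub.eventuallyLE)
  · refine setIntegral_mono_on ((integrableOn_exp_neg_Ioi R).const_mul _)
      (hint.mono_set hsub) measurableSet_Ioi fun t ht => ?_
    rw [mul_comm, add_sub_cancel_right]
    have : R ^ x ≤ t ^ x := Real.rpow_le_rpow hR (le_of_lt ht) hx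
    gcongr
  · filter_upwards [ae_restrict_mem measurableSet_Ioi] with t ht
    have : (0 : ℝ) < t := ht
    simp only [Pi.zero_apply]
    positivity

theorem summable_pow_div_Gamma {α : ℝ} (hα : 0 < α) (B : ℝ) :
    Summable fun k : ℕ => B ^ k / Real.Gamma (α * k + 1) := by
  -- Chosen so that `R ^ (α k) = (2(|B| + 1)) ^ k`, which beats `|B| ^ k` by a factor `2 ^ k`.
  set R : ℝ := (2 * (|B| + 1)) ^ α⁻¹
  have hR : 0 ≤ R := by positivity
  have hRα : R ^ α = 2 * (|B| + 1) := by
    rw [← Real.rpow_mul (by positivity), inv_mul_cancel₀ hα.ne', Real.rpow_one]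
  have hpow (k : ℕ) : R ^ (α * k) = (2 * (|B| + 1)) ^ k := by
    rw [Real.rpow_mul hR, hRα, Real.rpow_natCast]
  refine Summable.of_norm_bounded (g := fun k : ℕ => Real.exp R * (1 / 2) ^ k)
    (summable_geometric_two.mul_left _) fun k => ?_
  have hG := rpow_mul_exp_neg_le_Gamma (x := α * k) (by positivity) hR
  rw [hpow] at hG
  have hpos : 0 < (2 * (|B| + 1)) ^ k * Real.exp (-R) := by positivity
  rw [norm_div, norm_pow, Real.norm_eq_abs, Real.norm_of_nonneg (hpos.le.trans hG),
    div_le_iff₀ (hpos.trans_le hG)]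
  calc |B| ^ k ≤ (|B| + 1) ^ k := by gcongr; linarith
    _ = Real.exp R * (1 / 2) ^ k * ((2 * (|B| + 1)) ^ k * Real.exp (-R)) := by
        rw [mul_pow, Real.exp_neg]
        field_simp
        rw [← mul_pow]
        norm_num
    _ ≤ _ := by gcongr

theorem norm_mittagLeffler_term {α : ℝ} (hα : 0 < α) (z : ℂ) (k : ℕ) :
    ‖z ^ k / (Real.Gamma (α * k + 1) : ℂ)‖ = ‖z‖ ^ k / Real.Gamma (α * k + 1) := by
  have : 0 < Real.Gamma (α * k + 1) := Real.Gamma_pos_of_pos (by positivity)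
  rw [norm_div, norm_pow, Complex.norm_real, Real.norm_of_nonneg this.le]

theorem summable_mittagLeffler {α : ℝ} (hα : 0 < α) (z : ℂ) :
    Summable fun k : ℕ => z ^ k / (Real.Gamma (α * k + 1) : ℂ) := by
  refine Summable.of_norm ?_
  simp_rw [norm_mittagLeffler_term hα]
  exact summable_pow_div_Gamma hα _

theorem mittagLeffler_conj (α : ℝ) (z : ℂ) :
    mittagLeffler α (starRingEnd ℂ z) = starRingEnd ℂ (mittagLeffler α z) := by
  simp only [mittagLeffler, Complex.conj_tsum, map_div₀, map_pow, Complex.conj_ofReal]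

theorem continuous_mittagLeffler {α : ℝ} (hα : 0 < α) : Continuous (mittagLeffler α) := by
  rw [continuous_iff_continuousAt]
  intro z
  have hball : Metric.ball (0 : ℂ) (‖z‖ + 1) ∈ 𝓝 z :=
    Metric.isOpen_ball.mem_nhds (by simp)
  refine ContinuousOn.continuousAt ?_ hball
  refine continuousOn_tsum (u := fun k : ℕ => (‖z‖ + 1) ^ k / Real.Gamma (α * k + 1))
    (fun k => by fun_prop) (summable_pow_div_Gamma hα _) fun k w hw => ?_
  rw [norm_mittagLeffler_term hα]
  have hw' : ‖w‖ ≤ ‖z‖ + 1 := (mem_ball_zero_iff.1 hw).le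
  have : 0 < Real.Gamma (α * k + 1) := Real.Gamma_pos_of_pos (by positivity)
  gcongr

/-! ### Riemann-Liouville integrals -/

theorem integral_sub_rpow_mul_rpow {β γ t : ℝ} (hβ : 0 < β) (hγ : 0 < γ) (ht : 0 < t) :
    ∫ τ in (0 : ℝ)..t, (t - τ) ^ (β - 1) * τ ^ (γ - 1) =
      Real.Gamma β * Real.Gamma γ / Real.Gamma (β + γ) * t ^ (β + γ - 1) := by
  have h := Complex.betaIntegral_scaled (γ : ℂ) (β : ℂ) ht
  rw [Complex.betaIntegral_eq_Gamma_mul_div _ _ (by simpa) (by simpa)] at h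
  have h2 : ∫ x in (0 : ℝ)..t, (x : ℂ) ^ ((γ : ℂ) - 1) * ((t : ℂ) - x) ^ ((β : ℂ) - 1) =
      ∫ x in (0 : ℝ)..t, (((t - x) ^ (β - 1) * x ^ (γ - 1) : ℝ) : ℂ) := by
    refine intervalIntegral.integral_congr fun x hx => ?_
    rw [Set.uIcc_of_le ht.le] at hx
    rw [Complex.ofReal_mul, Complex.ofReal_cpow hx.1, Complex.ofReal_cpow (by linarith [hx.2])]
    push_cast
    ring
  rw [h2, intervalIntegral.integral_ofReal] at h
  apply Complex.ofReal_injective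
  rw [h]
  push_cast
  rw [Complex.ofReal_cpow ht.le]
  simp only [Complex.Gamma_ofReal, ← Complex.ofReal_add]
  push_cast
  rw [add_comm (γ : ℂ) β, add_comm γ β]
  ring

theorem intervalIntegrable_sub_rpow_mul_rpow {β γ t : ℝ} (hβ : 0 < β) (hγ : 0 < γ) (ht : 0 < t) :
    IntervalIntegrable (fun τ => (t - τ) ^ (β - 1) * τ ^ (γ - 1)) volume 0 t := by
  -- A non-integrable function has integral `0` by convention, so a nonzero value proves
  -- integrability.
  apply intervalIntegral.intervalIntegrable_of_integral_ne_zero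
  rw [integral_sub_rpow_mul_rpow hβ hγ ht]
  have := Real.Gamma_pos_of_pos hβ
  have := Real.Gamma_pos_of_pos hγ
  have := Real.Gamma_pos_of_pos (add_pos hβ hγ)
  positivity

theorem intervalIntegrable_sub_rpow {β t : ℝ} (hβ : 0 < β) (ht : 0 < t) :
    IntervalIntegrable (fun τ => (t - τ) ^ (β - 1)) volume 0 t := by
  simpa using intervalIntegrable_sub_rpow_mul_rpow hβ one_pos ht

/-- The exponents of the Beta integral add up to `0`, so the value does not depend on `t - τ`. This
makes the two fractional kernels inverse to each other. -/
theorem integral_sub_rpow_mul_sub_rpow {α τ t : ℝ} (hα₀ : 0 < α) (hα₁ : α < 1) (h : τ < t) :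
    ∫ s in τ..t, (t - s) ^ (α - 1) * (s - τ) ^ (-α) = Real.Gamma α * Real.Gamma (1 - α) := by
  have h1 := integral_sub_rpow_mul_rpow hα₀ (sub_pos.2 hα₁) (sub_pos.2 h)
  have h2 := intervalIntegral.integral_comp_sub_right (a := τ) (b := t)
    (fun s => (t - τ - s) ^ (α - 1) * s ^ (1 - α - 1)) τ
  rw [sub_self, h1] at h2
  simpa using h2

/-- Fubini on the triangle `τ < s ≤ t`: with `s` integrated first, the kernel contributes a
constant. -/
theorem integral_rpow_mul_integral_rpow_mul {α t : ℝ} (hα₀ : 0 < α) (hα₁ : α < 1) (ht : 0 < t)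
    {g : ℝ → ℝ} (hg : IntervalIntegrable g volume 0 t) :
    ∫ s in (0 : ℝ)..t, (t - s) ^ (α - 1) * ∫ τ in (0 : ℝ)..s, (s - τ) ^ (-α) * g τ =
      Real.Gamma α * Real.Gamma (1 - α) * ∫ τ in (0 : ℝ)..t, g τ := by
  set μ : Measure ℝ := volume.restrict (Set.Ioc 0 t) with hμ
  have hgμ : Integrable g μ := (intervalIntegrable_iff_integrableOn_Ioc_of_le ht.le).1 hg
  let K : ℝ → ℝ → ℝ := fun s τ => (Set.Ioi τ).indicator
    (fun s => (t - s) ^ (α - 1) * (s - τ) ^ (-α)) s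
  have hKmeas : Measurable (fun p : ℝ × ℝ => K p.1 p.2) := by
    have : (fun p : ℝ × ℝ => K p.1 p.2) = {p : ℝ × ℝ | p.2 < p.1}.indicator
        (fun p => (t - p.1) ^ (α - 1) * (p.1 - p.2) ^ (-α)) := by
      ext p
      simp [K, Set.indicator_apply]
    rw [this]
    exact Measurable.indicator (by fun_prop) (measurableSet_lt measurable_snd measurable_fst)
  have hinter {τ : ℝ} (hτ : τ ∈ Set.Ioc 0 t) : Set.Ioi τ ∩ Set.Ioc 0 t = Set.Ioc τ t := by
    ext s
    simp only [Set.mem_inter_iff, Set.mem_Ioi, Set.mem_Ioc]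
    constructor
    · tauto
    · exact fun h => ⟨h.1, hτ.1.trans h.1, h.2⟩
  have hKint {τ : ℝ} (hτ : τ ∈ Set.Ioo 0 t) :
      ∫ s, K s τ ∂μ = Real.Gamma α * Real.Gamma (1 - α) := by
    rw [← integral_sub_rpow_mul_sub_rpow hα₀ hα₁ hτ.2, hμ,
      integral_indicator measurableSet_Ioi, Measure.restrict_restrict measurableSet_Ioi,
      hinter ⟨hτ.1, hτ.2.le⟩, intervalIntegral.integral_of_le hτ.2.le]
  have hΓ : 0 < Real.Gamma α * Real.Gamma (1 - α) :=
    mul_pos (Real.Gamma_pos_of_pos hα₀) (Real.Gamma_pos_of_pos (by linarith))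
  have hKI {τ : ℝ} (hτ : τ ∈ Set.Ioo 0 t) : Integrable (fun s => K s τ) μ := by
    by_contra h
    have := hKint hτ
    rw [integral_undef h] at this
    exact hΓ.ne this
  have hmem : ∀ᵐ s ∂μ, s ∈ Set.Ioo 0 t := by
    rw [hμ, ← restrict_Ioo_eq_restrict_Ioc]
    exact ae_restrict_mem measurableSet_Ioo
  have hK0 {τ : ℝ} : ∀ᵐ s ∂μ, 0 ≤ K s τ := by
    filter_upwards [hmem] with s hs
    refine Set.indicator_apply_nonneg fun h => ?_
    have h : τ < s := h
    exact mul_nonneg (Real.rpow_nonneg (by linarith [hs.2]) _) (Real.rpow_nonneg (by linarith) _)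
  -- Tonelli: `K ≥ 0` has constant mass in `s`, so the double integral of the norm is a multiple of
  -- `∫ |g|`.
  have hprod : Integrable (Function.uncurry fun s τ => K s τ * g τ) (μ.prod μ) := by
    have hmeas : AEStronglyMeasurable (Function.uncurry fun s τ => K s τ * g τ) (μ.prod μ) :=
      hKmeas.aestronglyMeasurable.mul hgμ.aestronglyMeasurable.comp_snd
    rw [integrable_prod_iff' hmeas]
    constructor
    · filter_upwards [hmem] with τ hτ
      exact (hKI hτ).mul_const (g τ)
    · refine (hgμ.norm.const_mul (Real.Gamma α * Real.Gamma (1 - α))).congr ?_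
      filter_upwards [hmem] with τ hτ
      simp only [Function.uncurry_apply_pair, norm_mul]
      rw [integral_mul_const, ← hKint hτ]
      congr 1
      refine integral_congr_ae ?_
      filter_upwards [hK0 (τ := τ)] with s hs
      rw [Real.norm_of_nonneg hs]
  calc ∫ s in (0 : ℝ)..t, (t - s) ^ (α - 1) * ∫ τ in (0 : ℝ)..s, (s - τ) ^ (-α) * g τ
      = ∫ s, ∫ τ, K s τ * g τ ∂μ ∂μ := by
        rw [intervalIntegral.integral_of_le ht.le]
        refine integral_congr_ae ?_
        filter_upwards [hmem] with s hs
        have : (fun τ => K s τ * g τ) = (Set.Iio s).indicator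
            fun τ => (t - s) ^ (α - 1) * ((s - τ) ^ (-α) * g τ) := by
          ext τ
          by_cases h : τ < s <;> simp [K, h, mul_assoc]
        rw [this, hμ, integral_indicator measurableSet_Iio,
          Measure.restrict_restrict measurableSet_Iio, integral_const_mul,
          intervalIntegral.integral_of_le hs.1.le, ← restrict_Ioo_eq_restrict_Ioc]
        congr 3
        ext τ
        simp only [Set.mem_inter_iff, Set.mem_Iio, Set.mem_Ioc, Set.mem_Ioo]
        constructor
        · exact fun h => ⟨h.2, h.1, h.2.le.trans hs.2.le⟩
        · exact fun h => ⟨h.2.1, h.1⟩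
    _ = ∫ τ, ∫ s, K s τ * g τ ∂μ ∂μ := integral_integral_swap hprod
    _ = ∫ τ, Real.Gamma α * Real.Gamma (1 - α) * g τ ∂μ := by
        refine integral_congr_ae ?_
        filter_upwards [hmem] with τ hτ
        rw [integral_mul_const, hKint hτ]
    _ = _ := by rw [integral_const_mul, intervalIntegral.integral_of_le ht.le]

/-- The Riemann-Liouville integral of order `α` inverts the Caputo derivative. -/
theorem integral_rpow_mul_caputoDeriv {α T : ℝ} (hα₀ : 0 < α) (hα₁ : α < 1) (hT : 0 < T)
    {f : ℝ → ℝ} (hf : AbsolutelyContinuousOnInterval f 0 T) :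
    ∫ s in (0 : ℝ)..T, (T - s) ^ (α - 1) * caputoDeriv α f s =
      Real.Gamma α * (f T - f 0) := by
  have h := integral_rpow_mul_integral_rpow_mul hα₀ hα₁ hT hf.intervalIntegrable_deriv
  rw [hf.integral_deriv_eq_sub] at h
  have hΓ : 0 < Real.Gamma (1 - α) := Real.Gamma_pos_of_pos (by linarith)
  simp only [caputoDeriv, mul_left_comm _ (1 / Real.Gamma (1 - α)),
    intervalIntegral.integral_const_mul]
  rw [h]
  field_simp

/-- A Gronwall inequality for the weakly singular kernel `(t - s) ^ (α - 1)`. -/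
theorem eq_zero_of_le_integral_rpow_mul {α K T : ℝ} (hα : 0 < α) (hK : 0 ≤ K) (hT : 0 ≤ T)
    {m : ℝ → ℝ} (hm : ContinuousOn m (Set.Icc 0 T)) (hm0 : ∀ t ∈ Set.Icc 0 T, 0 ≤ m t)
    (h : ∀ t ∈ Set.Icc 0 T, m t ≤ K * ∫ s in (0 : ℝ)..t, (t - s) ^ (α - 1) * m s) :
    ∀ t ∈ Set.Icc 0 T, m t = 0 := by
  have hΓ : 0 < Real.Gamma α := Real.Gamma_pos_of_pos hα
  -- In the weighted norm `sup e^{-Nt} |m t|` the Volterra operator has norm at most `K ∫₀^∞ u^(α-1)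
  -- e^{-Nu} du = K N^(-α) Γ(α)`. A large `N` makes this at most `1/2`, hence `S ≤ S/2` for the
  -- weighted maximum `S`.
  obtain ⟨N, hN, hNK⟩ : ∃ N : ℝ, 0 < N ∧ K * ((1 / N) ^ α * Real.Gamma α) ≤ 1 / 2 := by
    refine ⟨(2 * (K * Real.Gamma α + 1)) ^ α⁻¹, by positivity, ?_⟩
    rw [one_div, Real.inv_rpow (by positivity), ← Real.rpow_mul (by positivity),
      inv_mul_cancel₀ hα.ne', Real.rpow_one]
    have : 0 < 2 * (K * Real.Gamma α + 1) := by positivity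
    rw [mul_left_comm, inv_mul_le_iff₀ this]
    linarith
  obtain ⟨t₀, ht₀, hmax⟩ := isCompact_Icc.exists_isMaxOn (Set.nonempty_Icc.2 hT)
    (f := fun t => Real.exp (-(N * t)) * m t) (by fun_prop)
  set S : ℝ := Real.exp (-(N * t₀)) * m t₀ with hS
  have hle : ∀ s ∈ Set.Icc 0 T, m s ≤ Real.exp (N * s) * S := fun s hs => by
    have h1 : Real.exp (-(N * s)) * m s ≤ S := hmax hs
    rwa [Real.exp_neg, inv_mul_le_iff₀ (Real.exp_pos _)] at h1
  have hS0 : 0 ≤ S := mul_nonneg (Real.exp_pos _).le (hm0 _ ht₀)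
  suffices hS' : S ≤ 0 by
    intro t ht
    refine le_antisymm ?_ (hm0 t ht)
    have := hle t ht
    rwa [le_antisymm hS' hS0, mul_zero] at this
  rcases ht₀.1.eq_or_lt with h0 | hpos
  · have := h t₀ ht₀
    rw [← h0] at this
    rw [hS, ← h0]
    simpa using this
  have hker := intervalIntegrable_sub_rpow hα hpos
  have hbound : ∫ s in (0 : ℝ)..t₀, (t₀ - s) ^ (α - 1) * m s ≤
      Real.exp (N * t₀) * S * ((1 / N) ^ α * Real.Gamma α) := by
    have hI := Real.integral_rpow_mul_exp_neg_mul_Ioi hα hN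
    have hIint : IntegrableOn (fun t : ℝ => t ^ (α - 1) * Real.exp (-(N * t))) (Set.Ioi 0) := by
      by_contra hc
      rw [integral_undef hc] at hI
      have : 0 < (1 / N) ^ α * Real.Gamma α := by positivity
      exact this.ne hI
    calc ∫ s in (0 : ℝ)..t₀, (t₀ - s) ^ (α - 1) * m s
        ≤ ∫ s in (0 : ℝ)..t₀, (t₀ - s) ^ (α - 1) * (Real.exp (N * s) * S) := by
          refine intervalIntegral.integral_mono_on hpos.le
            (hker.mul_continuousOn ?_) (hker.mul_continuousOn (by fun_prop)) fun s hs => ?_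
          · rw [Set.uIcc_of_le hpos.le]
            exact hm.mono (Set.Icc_subset_Icc_right ht₀.2)
          · exact mul_le_mul_of_nonneg_left (hle s ⟨hs.1, hs.2.trans ht₀.2⟩)
              (Real.rpow_nonneg (by linarith [hs.2]) _)
      _ = Real.exp (N * t₀) * S *
            ∫ s in (0 : ℝ)..t₀, s ^ (α - 1) * Real.exp (-(N * s)) := by
          have := intervalIntegral.integral_comp_sub_left (a := 0) (b := t₀)
            (fun s => s ^ (α - 1) * (Real.exp (N * (t₀ - s)) * S)) t₀
          simp only [sub_sub_cancel, sub_self, sub_zero] at this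
          rw [this, ← intervalIntegral.integral_const_mul]
          refine intervalIntegral.integral_congr fun s _ => ?_
          rw [mul_sub, sub_eq_add_neg (N * t₀), Real.exp_add]
          ring
      _ ≤ Real.exp (N * t₀) * S * ((1 / N) ^ α * Real.Gamma α) := by
          refine mul_le_mul_of_nonneg_left ?_ (by positivity)
          rw [← hI, intervalIntegral.integral_of_le hpos.le]
          refine setIntegral_mono_set hIint ?_ Set.Ioc_subset_Ioi_self.eventuallyLE
          filter_upwards [ae_restrict_mem measurableSet_Ioi] with t ht
          have : (0 : ℝ) < t := ht
          simp only [Pi.zero_apply]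
          positivity
  have h1 := (h t₀ ht₀).trans (mul_le_mul_of_nonneg_left hbound hK)
  have h2 : S ≤ Real.exp (-(N * t₀)) *
      (K * (Real.exp (N * t₀) * S * ((1 / N) ^ α * Real.Gamma α))) :=
    mul_le_mul_of_nonneg_left h1 (Real.exp_pos _).le
  have h3 : Real.exp (-(N * t₀)) * (K * (Real.exp (N * t₀) * S * ((1 / N) ^ α * Real.Gamma α))) =
      K * ((1 / N) ^ α * Real.Gamma α) * S := by
    rw [Real.exp_neg]
    field_simp
  rw [h3] at h2
  nlinarith

/-! ### Power series in `t ^ α` and their Caputo derivatives -/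

theorem integrable_tsum_of_summable_integral_norm {X E : Type*} [MeasurableSpace X]
    {μ : Measure X} [NormedAddCommGroup E] [CompleteSpace E] [MeasurableSpace E] [BorelSpace E]
    [SecondCountableTopology E]
    {F : ℕ → X → E} (hF : ∀ n, Integrable (F n) μ) (hs : Summable fun n => ∫ x, ‖F n x‖ ∂μ) :
    Integrable (fun x => ∑' n, F n x) μ := by
  refine ⟨(AEMeasurable.tsum fun n => (hF n).aemeasurable).aestronglyMeasurable, ?_⟩
  calc ∫⁻ x, ‖∑' n, F n x‖ₑ ∂μ ≤ ∫⁻ x, ∑' n, ‖F n x‖ₑ ∂μ :=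
        lintegral_mono fun x => enorm_tsum_le_tsum_enorm
    _ = ∑' n, ∫⁻ x, ‖F n x‖ₑ ∂μ := lintegral_tsum fun n => (hF n).aestronglyMeasurable.enorm
    _ = ∑' n, ENNReal.ofReal (∫ x, ‖F n x‖ ∂μ) := by
        simp_rw [ofReal_integral_norm_eq_lintegral_enorm (hF _)]
    _ = ENNReal.ofReal (∑' n, ∫ x, ‖F n x‖ ∂μ) :=
        (ENNReal.ofReal_tsum_of_nonneg (fun n => integral_nonneg fun x => norm_nonneg _) hs).symm
    _ < ⊤ := ENNReal.ofReal_lt_top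

/-- The series `∑ cₖ t ^ (α k) / Γ(α k + 1)`. -/
noncomputable def fracSeries (α : ℝ) (c : ℕ → ℝ) (t : ℝ) : ℝ :=
  ∑' k : ℕ, c k * (t ^ (α * k) / Real.Gamma (α * k + 1))

/-- The termwise derivative of `fracSeries α c`. -/
noncomputable def fracSeriesDeriv (α : ℝ) (c : ℕ → ℝ) (t : ℝ) : ℝ :=
  ∑' k : ℕ, c (k + 1) * (t ^ (α * k + α - 1) / Real.Gamma (α * k + α))

theorem fracSeries_zero {α : ℝ} (hα : 0 < α) (c : ℕ → ℝ) : fracSeries α c 0 = c 0 := by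
  rw [fracSeries, tsum_eq_single 0]
  · simp
  · intro k hk
    have : (α * k) ≠ 0 := by positivity
    simp [Real.zero_rpow this]

theorem summable_fracSeries {α D B : ℝ} (hα : 0 < α) {c : ℕ → ℝ} (hc : ∀ k, |c k| ≤ D * B ^ k)
    {t : ℝ} (ht : 0 ≤ t) :
    Summable fun k : ℕ => |c k| * (t ^ (α * k) / Real.Gamma (α * k + 1)) := by
  have hΓ (k : ℕ) : 0 < Real.Gamma (α * k + 1) := Real.Gamma_pos_of_pos (by positivity)
  refine Summable.of_nonneg_of_le (fun k => ?_) (fun k => ?_)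
    ((summable_pow_div_Gamma hα (B * t ^ α)).mul_left D)
  · have := hΓ k
    positivity
  · have h1 := hΓ k
    rw [mul_pow, ← Real.rpow_natCast (t ^ α), ← Real.rpow_mul ht]
    calc _ ≤ D * B ^ k * (t ^ (α * k) / Real.Gamma (α * k + 1)) :=
          mul_le_mul_of_nonneg_right (hc k) (by positivity)
      _ = _ := by ring

/-- Termwise Beta integrals. The order `β` is free because two cases are needed: `β = 1` recovers
the series from its derivative, and `β = 1 - α` gives the Caputo derivative. -/
theorem hasSum_integral_fracSeriesDeriv {α β t : ℝ} (hα : 0 < α) (hβ : 0 < β) (ht : 0 < t)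
    {c : ℕ → ℝ} (hs : Summable fun k : ℕ =>
      |c (k + 1)| * (t ^ (α * k + α + β - 1) / Real.Gamma (α * k + α + β))) :
    IntervalIntegrable (fun τ => (t - τ) ^ (β - 1) * fracSeriesDeriv α c τ) volume 0 t ∧
    HasSum (fun k : ℕ => Real.Gamma β *
        (c (k + 1) * (t ^ (α * k + α + β - 1) / Real.Gamma (α * k + α + β))))
      (∫ τ in (0 : ℝ)..t, (t - τ) ^ (β - 1) * fracSeriesDeriv α c τ) := by
  have hγ (k : ℕ) : 0 < α * k + α := by positivity
  have hΓ (k : ℕ) : 0 < Real.Gamma (α * k + α) := Real.Gamma_pos_of_pos (hγ k)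
  let F : ℕ → ℝ → ℝ := fun k τ => c (k + 1) / Real.Gamma (α * k + α) *
    ((t - τ) ^ (β - 1) * τ ^ (α * k + α - 1))
  have hF (k : ℕ) : Integrable (F k) (volume.restrict (Set.Ioc 0 t)) :=
    ((intervalIntegrable_iff_integrableOn_Ioc_of_le ht.le).1
      (intervalIntegrable_sub_rpow_mul_rpow hβ (hγ k) ht)).const_mul _
  have hint (b : ℝ) (k : ℕ) : ∫ τ in Set.Ioc 0 t, b / Real.Gamma (α * k + α) *
      ((t - τ) ^ (β - 1) * τ ^ (α * k + α - 1)) =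
      Real.Gamma β * (b * (t ^ (α * k + α + β - 1) / Real.Gamma (α * k + α + β))) := by
    rw [integral_const_mul, ← intervalIntegral.integral_of_le ht.le,
      integral_sub_rpow_mul_rpow hβ (hγ k) ht, add_comm β]
    have := hΓ k
    field_simp
  have hnorm (k : ℕ) : ∫ τ in Set.Ioc 0 t, ‖F k τ‖ =
      Real.Gamma β * (|c (k + 1)| * (t ^ (α * k + α + β - 1) / Real.Gamma (α * k + α + β))) := by
    rw [← hint]
    refine setIntegral_congr_fun measurableSet_Ioc fun τ hτ => ?_
    simp only [F, norm_mul, norm_div, Real.norm_eq_abs]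
    rw [abs_of_pos (hΓ k), abs_of_nonneg (Real.rpow_nonneg (by linarith [hτ.2]) _),
      abs_of_nonneg (Real.rpow_nonneg hτ.1.le _)]
  have hsum : Summable fun k => ∫ τ in Set.Ioc 0 t, ‖F k τ‖ := by
    simp_rw [hnorm]
    exact hs.mul_left _
  have heq (τ : ℝ) : (t - τ) ^ (β - 1) * fracSeriesDeriv α c τ = ∑' k, F k τ := by
    rw [fracSeriesDeriv, ← tsum_mul_left]
    refine tsum_congr fun k => ?_
    simp only [F]
    ring
  simp_rw [heq]
  constructor
  · rw [intervalIntegrable_iff_integrableOn_Ioc_of_le ht.le]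
    exact integrable_tsum_of_summable_integral_norm hF hsum
  · rw [intervalIntegral.integral_of_le ht.le]
    have := hasSum_integral_of_summable_integral_norm hF hsum
    simpa only [F, hint] using this

section

variable {α D B : ℝ} {c : ℕ → ℝ}

theorem intervalIntegrable_fracSeriesDeriv (hα : 0 < α) (hc : ∀ k, |c k| ≤ D * B ^ k)
    {t : ℝ} (ht : 0 < t) :
    IntervalIntegrable (fracSeriesDeriv α c) volume 0 t ∧
      fracSeries α c t = c 0 + ∫ τ in (0 : ℝ)..t, fracSeriesDeriv α c τ := by
  have hs := summable_fracSeries hα hc ht.le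
  have hexp (k : ℕ) : α * (k + 1 : ℕ) = α * k + α := by push_cast; ring
  have h := hasSum_integral_fracSeriesDeriv hα one_pos ht (c := c) (by
    have := (summable_nat_add_iff 1).2 hs
    simpa only [hexp, add_sub_cancel_right] using this)
  simp only [sub_self, Real.rpow_zero, one_mul, Real.Gamma_one, add_sub_cancel_right] at h
  refine ⟨h.1, ?_⟩
  have hs' : Summable fun k : ℕ => c k * (t ^ (α * k) / Real.Gamma (α * k + 1)) := by
    refine Summable.of_norm (hs.congr fun k => ?_)
    have : 0 < Real.Gamma (α * k + 1) := Real.Gamma_pos_of_pos (by positivity)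
    rw [norm_mul, Real.norm_eq_abs, Real.norm_of_nonneg (by positivity)]
  rw [fracSeries, hs'.tsum_eq_zero_add, ← h.2.tsum_eq]
  simp only [hexp]
  simp

/-- The series is an indefinite integral, so Lebesgue differentiation applies. Almost everywhere
suffices, since the derivative only enters under an integral. -/
theorem ae_deriv_fracSeries (hα : 0 < α) (hc : ∀ k, |c k| ≤ D * B ^ k) {T : ℝ} (hT : 0 < T) :
    ∀ᵐ t, t ∈ Set.Ioc 0 T → deriv (fracSeries α c) t = fracSeriesDeriv α c t := by
  filter_upwards [(intervalIntegrable_fracSeriesDeriv hα hc hT).1.ae_hasDerivAt_integral]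
    with t h ht
  rw [Set.uIcc_of_le hT.le] at h
  have h1 := (h ⟨ht.1.le, ht.2⟩ 0 ⟨le_rfl, hT.le⟩).const_add (c 0)
  refine (h1.congr_of_eventuallyEq ?_).deriv
  filter_upwards [Ioi_mem_nhds ht.1] with s hs
  exact (intervalIntegrable_fracSeriesDeriv hα hc hs).2

theorem absolutelyContinuousOnInterval_fracSeries (hα : 0 < α) (hc : ∀ k, |c k| ≤ D * B ^ k)
    {T : ℝ} (hT : 0 < T) : AbsolutelyContinuousOnInterval (fracSeries α c) 0 T := by
  have h := (intervalIntegrable_fracSeriesDeriv hα hc hT).1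
    |>.absolutelyContinuousOnInterval_intervalIntegral (c := 0) Set.left_mem_uIcc
  have h0 : AbsolutelyContinuousOnInterval (fun _ : ℝ => c 0) 0 T :=
    (LipschitzWith.const (c 0)).lipschitzOnWith.absolutelyContinuousOnInterval
  have hadd := h0.add h
  -- The integral formula is available only on `[0, T]`, so the property is transferred through its
  -- `ε`-`δ` form.
  rw [absolutelyContinuousOnInterval_iff] at hadd ⊢
  have heq : ∀ t ∈ Set.uIcc 0 T, fracSeries α c t = c 0 + ∫ τ in (0 : ℝ)..t,
      fracSeriesDeriv α c τ := by
    intro t ht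
    rw [Set.uIcc_of_le hT.le] at ht
    rcases ht.1.eq_or_lt with rfl | h0
    · simp [fracSeries_zero hα]
    · exact (intervalIntegrable_fracSeriesDeriv hα hc h0).2
  intro ε hε
  obtain ⟨δ, hδ, H⟩ := hadd ε hε
  refine ⟨δ, hδ, fun E hE hlt => ?_⟩
  have := H E hE hlt
  convert this using 2 with i hi
  rw [heq _ (hE.1 i hi).1, heq _ (hE.1 i hi).2]
  rfl

/-- The case `β = 1 - α`. It holds at every `t > 0`, which is what yields a solution satisfying the
equation everywhere. -/
theorem caputoDeriv_fracSeries (hα₀ : 0 < α) (hα₁ : α < 1) (hc : ∀ k, |c k| ≤ D * B ^ k)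
    {t : ℝ} (ht : 0 < t) :
    caputoDeriv α (fracSeries α c) t = fracSeries α (fun k => c (k + 1)) t := by
  have hexp (k : ℕ) : α * k + α + (1 - α) = α * k + 1 := by ring
  have hs := summable_fracSeries hα₀ (c := fun k => c (k + 1)) (D := D * B) (B := B)
    (fun k => (hc (k + 1)).trans_eq (by ring)) ht.le
  have h := hasSum_integral_fracSeriesDeriv hα₀ (sub_pos.2 hα₁) ht (c := c)
    (by simpa only [hexp, add_sub_cancel_right] using hs)
  simp only [hexp, add_sub_cancel_right] at h
  have hΓ : 0 < Real.Gamma (1 - α) := Real.Gamma_pos_of_pos (by linarith)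
  rw [caputoDeriv, fracSeries]
  have hcongr : ∫ τ in (0 : ℝ)..t, (t - τ) ^ (-α) * deriv (fracSeries α c) τ =
      ∫ τ in (0 : ℝ)..t, (t - τ) ^ (1 - α - 1) * fracSeriesDeriv α c τ := by
    refine intervalIntegral.integral_congr_ae ?_
    filter_upwards [ae_deriv_fracSeries hα₀ hc ht] with τ h hτ
    rw [Set.uIoc_of_le ht.le] at hτ
    rw [h hτ, show 1 - α - 1 = -α by ring]
  rw [hcongr, ← h.2.tsum_eq, tsum_mul_left]
  field_simp

end

/-! ### The planar linear Caputo system -/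

/-- The integral does not see null sets, so the almost-everywhere equation becomes a Volterra
equation at every `t > 0`. -/
theorem IsCaputoSolution.integral_eq {n : ℕ} {α : ℝ} {A : Matrix (Fin n) (Fin n) ℝ}
    {X₀ : EuclideanSpace ℝ (Fin n)} {X : ℝ → EuclideanSpace ℝ (Fin n)}
    (hα₀ : 0 < α) (hα₁ : α < 1) (h : IsCaputoSolution α A X₀ X) (i : Fin n) {t : ℝ} (ht : 0 < t) :
    ∫ s in (0 : ℝ)..t, (t - s) ^ (α - 1) * A.mulVec (fun j => X s j) i =
      Real.Gamma α * (X t i - X₀ i) := by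
  have h1 := integral_rpow_mul_caputoDeriv hα₀ hα₁ ht (h.absCont i t ht)
  rw [h.init] at h1
  rw [← h1]
  refine intervalIntegral.integral_congr_ae ?_
  have h2 := h.equation i
  rw [ae_restrict_iff' measurableSet_Ioi] at h2
  filter_upwards [h2] with s hs hst
  rw [Set.uIoc_of_le ht.le] at hst
  rw [hs hst.1]

/-- The difference of two solutions solves the homogeneous Volterra equation; Gronwall is applied to
its `ℓ¹` norm `m`. -/
theorem IsCaputoSolution.eq_of_planar {α : ℝ} {A : Matrix (Fin 2) (Fin 2) ℝ}
    {X₀ : EuclideanSpace ℝ (Fin 2)} {X Y : ℝ → EuclideanSpace ℝ (Fin 2)}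
    (hα₀ : 0 < α) (hα₁ : α < 1) (hX : IsCaputoSolution α A X₀ X) (hY : IsCaputoSolution α A X₀ Y)
    {t : ℝ} (ht : 0 ≤ t) : X t = Y t := by
  rcases ht.eq_or_lt with rfl | ht0
  · rw [hX.init, hY.init]
  let w : Fin 2 → ℝ → ℝ := fun i s => X s i - Y s i
  let m : ℝ → ℝ := fun s => |w 0 s| + |w 1 s|
  let N : ℝ := |A 0 0| + |A 0 1| + |A 1 0| + |A 1 1|
  have hΓ : 0 < Real.Gamma α := Real.Gamma_pos_of_pos hα₀
  have hXc (i : Fin 2) : ContinuousOn (fun s => X s i) (Set.Icc 0 t) := by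
    simpa [Set.uIcc_of_le ht] using (hX.absCont i t ht0).continuousOn
  have hYc (i : Fin 2) : ContinuousOn (fun s => Y s i) (Set.Icc 0 t) := by
    simpa [Set.uIcc_of_le ht] using (hY.absCont i t ht0).continuousOn
  have hwc (i : Fin 2) : ContinuousOn (w i) (Set.Icc 0 t) := (hXc i).sub (hYc i)
  have hmc : ContinuousOn m (Set.Icc 0 t) := (hwc 0).abs.add (hwc 1).abs
  have hkey (i : Fin 2) {s : ℝ} (hs : s ∈ Set.Ioc 0 t) : Real.Gamma α * |w i s| ≤
      (|A i 0| + |A i 1|) * ∫ τ in (0 : ℝ)..s, (s - τ) ^ (α - 1) * m τ := by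
    have hker := intervalIntegrable_sub_rpow hα₀ hs.1
    have hsub : Set.uIcc 0 s ⊆ Set.Icc 0 t := by
      rw [Set.uIcc_of_le hs.1.le]
      exact Set.Icc_subset_Icc_right hs.2
    have hI {f : ℝ → ℝ} (hf : ContinuousOn f (Set.Icc 0 t)) :
        IntervalIntegrable (fun τ => (s - τ) ^ (α - 1) * f τ) volume 0 s :=
      hker.mul_continuousOn (hf.mono hsub)
    have hmul {Z : ℝ → EuclideanSpace ℝ (Fin 2)}
        (hZ : ∀ i, ContinuousOn (fun s => Z s i) (Set.Icc 0 t)) :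
        ContinuousOn (fun τ => A.mulVec (fun j => Z τ j) i) (Set.Icc 0 t) := by
      simp only [Matrix.mulVec, dotProduct, Fin.sum_univ_two]
      exact ((hZ 0).const_mul _).add ((hZ 1).const_mul _)
    have heq : Real.Gamma α * w i s = ∫ τ in (0 : ℝ)..s,
        (s - τ) ^ (α - 1) * (A i 0 * w 0 τ + A i 1 * w 1 τ) := by
      have h1 := hX.integral_eq hα₀ hα₁ i hs.1
      have h2 := hY.integral_eq hα₀ hα₁ i hs.1
      have h3 : Real.Gamma α * w i s =
          Real.Gamma α * (X s i - X₀ i) - Real.Gamma α * (Y s i - X₀ i) := by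
        simp only [w]
        ring
      rw [h3, ← h1, ← h2, ← intervalIntegral.integral_sub (hI (hmul hXc)) (hI (hmul hYc))]
      refine intervalIntegral.integral_congr fun τ _ => ?_
      simp only [Matrix.mulVec, dotProduct, Fin.sum_univ_two, w]
      ring
    rw [← abs_of_pos hΓ, ← abs_mul, heq, ← intervalIntegral.integral_const_mul]
    refine (intervalIntegral.abs_integral_le_integral_abs hs.1.le).trans ?_
    refine intervalIntegral.integral_mono_on hs.1.le ?_ ?_ fun τ hτ => ?_
    · exact (hI (((hwc 0).const_mul _).add ((hwc 1).const_mul _))).abs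
    · exact (hI hmc).const_mul _
    · have hk : 0 ≤ (s - τ) ^ (α - 1) := Real.rpow_nonneg (by linarith [hτ.2]) _
      rw [abs_mul, abs_of_nonneg hk, mul_left_comm]
      refine mul_le_mul_of_nonneg_left ?_ hk
      refine (abs_add_le _ _).trans ?_
      rw [abs_mul, abs_mul]
      have := mul_nonneg (abs_nonneg (A i 0)) (abs_nonneg (w 1 τ))
      have := mul_nonneg (abs_nonneg (A i 1)) (abs_nonneg (w 0 τ))
      simp only [m]
      linarith
  have hw0 (i : Fin 2) : w i 0 = 0 := by simp [w, hX.init, hY.init]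
  have hm := eq_zero_of_le_integral_rpow_mul (K := N / Real.Gamma α) hα₀ (by positivity) ht hmc
    (fun s _ => by positivity) (fun s hs => by
      rcases hs.1.eq_or_lt with rfl | h0
      · simp [m, hw0]
      · have h1 := hkey 0 ⟨h0, hs.2⟩
        have h2 := hkey 1 ⟨h0, hs.2⟩
        rw [div_mul_eq_mul_div, le_div_iff₀ hΓ]
        simp only [N]
        simp only [m] at h1 h2 ⊢
        linarith) t ⟨ht, le_rfl⟩
  have h0 : |w 0 t| = 0 := le_antisymm (by simp only [m] at hm; linarith [abs_nonneg (w 1 t)])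
    (abs_nonneg _)
  have h1 : |w 1 t| = 0 := le_antisymm (by simp only [m] at hm; linarith [abs_nonneg (w 0 t)])
    (abs_nonneg _)
  ext i
  fin_cases i
  · exact sub_eq_zero.1 (abs_eq_zero.1 h0)
  · exact sub_eq_zero.1 (abs_eq_zero.1 h1)

/-- The solution of the planar system in canonical form, as a pair of real series. -/
noncomputable def planarSolution (α : ℝ) (z l : ℂ) (t : ℝ) : EuclideanSpace ℝ (Fin 2) :=
  !₂[fracSeries α (fun k => (z * l ^ k).re) t, fracSeries α (fun k => (z * l ^ k).im) t]

theorem abs_re_mul_pow_le (z l : ℂ) (k : ℕ) : |(z * l ^ k).re| ≤ ‖z‖ * ‖l‖ ^ k := by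
  rw [← norm_pow, ← norm_mul]
  exact Complex.abs_re_le_norm _

theorem abs_im_mul_pow_le (z l : ℂ) (k : ℕ) : |(z * l ^ k).im| ≤ ‖z‖ * ‖l‖ ^ k := by
  rw [← norm_pow, ← norm_mul]
  exact Complex.abs_im_le_norm _

theorem hasSum_mittagLeffler_rpow {α t : ℝ} (hα : 0 < α) (ht : 0 ≤ t) (z l : ℂ) :
    HasSum (fun k : ℕ => z * l ^ k * ((t ^ (α * k) / Real.Gamma (α * k + 1) : ℝ) : ℂ))
      (z * mittagLeffler α (l * ((t ^ α : ℝ) : ℂ))) := by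
  refine ((summable_mittagLeffler hα (l * ((t ^ α : ℝ) : ℂ))).hasSum.mul_left z).congr_fun ?_
  intro k
  rw [mul_pow, ← Complex.ofReal_pow, ← Real.rpow_natCast (t ^ α), ← Real.rpow_mul ht]
  push_cast
  ring

theorem planarSolution_apply {α t : ℝ} (hα : 0 < α) (ht : 0 ≤ t) (z l : ℂ) :
    planarSolution α z l t 0 = (z * mittagLeffler α (l * ((t ^ α : ℝ) : ℂ))).re ∧
    planarSolution α z l t 1 = (z * mittagLeffler α (l * ((t ^ α : ℝ) : ℂ))).im := by
  have h := hasSum_mittagLeffler_rpow hα ht z l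
  constructor
  · have := (Complex.hasSum_re h).tsum_eq
    simp only [Complex.re_mul_ofReal] at this
    exact this
  · have := (Complex.hasSum_im h).tsum_eq
    simp only [Complex.im_mul_ofReal] at this
    exact this

/-- Shifting the coefficients `z l ^ k` multiplies them by `l = a - ib`, and in real and imaginary
parts this is the action of the matrix. -/
theorem caputoDeriv_planarSolution {α a b : ℝ} (hα₀ : 0 < α) (hα₁ : α < 1) (z : ℂ) {t : ℝ}
    (ht : 0 < t) (i : Fin 2) :
    caputoDeriv α (fun s => planarSolution α z ⟨a, -b⟩ s i) t =
      !![a, b; -b, a].mulVec (fun j => planarSolution α z ⟨a, -b⟩ t j) i := by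
  set l : ℂ := ⟨a, -b⟩ with hl
  have hre := summable_fracSeries hα₀ (abs_re_mul_pow_le z l) ht.le
  have him := summable_fracSeries hα₀ (abs_im_mul_pow_le z l) ht.le
  have hnn (k : ℕ) : 0 ≤ t ^ (α * k) / Real.Gamma (α * k + 1) := by
    have : 0 < Real.Gamma (α * k + 1) := Real.Gamma_pos_of_pos (by positivity)
    positivity
  have hre' : Summable fun k : ℕ => (z * l ^ k).re * (t ^ (α * k) / Real.Gamma (α * k + 1)) :=
    Summable.of_norm (hre.congr fun k => by
      rw [norm_mul, Real.norm_eq_abs, Real.norm_of_nonneg (hnn k)])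
  have him' : Summable fun k : ℕ => (z * l ^ k).im * (t ^ (α * k) / Real.Gamma (α * k + 1)) :=
    Summable.of_norm (him.congr fun k => by
      rw [norm_mul, Real.norm_eq_abs, Real.norm_of_nonneg (hnn k)])
  fin_cases i
  · refine (caputoDeriv_fracSeries hα₀ hα₁ (abs_re_mul_pow_le z l) ht).trans ?_
    simp only [Matrix.mulVec, dotProduct, Fin.sum_univ_two, planarSolution, fracSeries]
    simp only [Fin.zero_eta, Matrix.of_apply, Matrix.cons_val_zero, Matrix.cons_val_one,
      Matrix.cons_val', Matrix.cons_val_fin_one, Fin.isValue]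
    rw [← tsum_mul_left, ← tsum_mul_left,
      ← (hre'.mul_left a).tsum_add (him'.mul_left b)]
    refine tsum_congr fun k => ?_
    have : (z * l ^ (k + 1)).re = a * (z * l ^ k).re + b * (z * l ^ k).im := by
      rw [pow_succ, ← mul_assoc, Complex.mul_re, hl]
      ring
    rw [this]
    ring
  · refine (caputoDeriv_fracSeries hα₀ hα₁ (abs_im_mul_pow_le z l) ht).trans ?_
    simp only [Matrix.mulVec, dotProduct, Fin.sum_univ_two, planarSolution, fracSeries]
    simp only [Fin.mk_one, Matrix.of_apply, Matrix.cons_val_zero, Matrix.cons_val_one,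
      Matrix.cons_val', Matrix.cons_val_fin_one, Fin.isValue]
    rw [← tsum_mul_left, ← tsum_mul_left,
      ← (hre'.mul_left (-b)).tsum_add (him'.mul_left a)]
    refine tsum_congr fun k => ?_
    have : (z * l ^ (k + 1)).im = -b * (z * l ^ k).re + a * (z * l ^ k).im := by
      rw [pow_succ, ← mul_assoc, Complex.mul_im, hl]
      ring
    rw [this]
    ring

theorem isCaputoSolution_planarSolution {α a b C₁ C₂ : ℝ} (hα₀ : 0 < α) (hα₁ : α < 1) :
    IsCaputoSolution α !![a, b; -b, a] !₂[C₁, C₂] (planarSolution α ⟨C₁, C₂⟩ ⟨a, -b⟩) where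
  init := by
    ext i
    fin_cases i <;> simp [planarSolution, fracSeries_zero hα₀]
  absCont i T hT := by
    fin_cases i
    · exact absolutelyContinuousOnInterval_fracSeries hα₀ (abs_re_mul_pow_le _ _) hT
    · exact absolutelyContinuousOnInterval_fracSeries hα₀ (abs_im_mul_pow_le _ _) hT
  equation i := by
    filter_upwards [ae_restrict_mem measurableSet_Ioi] with t ht
    exact caputoDeriv_planarSolution hα₀ hα₁ _ ht i

/-! ### Laplace transform of the Mittag-Leffler function -/

theorem integrableOn_rpow_mul_exp_neg_mul_Ioi {s r : ℝ} (hs : 0 < s) (hr : 0 < r) :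
    IntegrableOn (fun t : ℝ => t ^ (s - 1) * Real.exp (-(r * t))) (Set.Ioi 0) := by
  by_contra hc
  have hI := Real.integral_rpow_mul_exp_neg_mul_Ioi hs hr
  rw [integral_undef hc] at hI
  have : 0 < (1 / r) ^ s * Real.Gamma s := mul_pos (by positivity) (Real.Gamma_pos_of_pos hs)
  exact this.ne hI

theorem integrableOn_rpow_mul_cexp_Ioi {s : ℝ} {p : ℂ} (hs : 0 < s) (hp : 0 < p.re) :
    IntegrableOn (fun t : ℝ => ((t ^ (s - 1) : ℝ) : ℂ) * Complex.exp (-(p * t))) (Set.Ioi 0) := by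
  refine (integrableOn_rpow_mul_exp_neg_mul_Ioi hs hp).mono' ?_ ?_
  · exact (by fun_prop : Measurable fun t : ℝ =>
      ((t ^ (s - 1) : ℝ) : ℂ) * Complex.exp (-(p * t))).aestronglyMeasurable
  · filter_upwards [ae_restrict_mem measurableSet_Ioi] with t ht
    rw [norm_mul, Complex.norm_real, Real.norm_of_nonneg (Real.rpow_nonneg (le_of_lt ht) _),
      Complex.norm_exp]
    simp

theorem norm_rpow_mul_cexp {t : ℝ} (ht : 0 ≤ t) (u : ℝ) (p : ℂ) :
    ‖((t ^ u : ℝ) : ℂ) * Complex.exp (-(p * t))‖ = t ^ u * Real.exp (-(p.re * t)) := by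
  rw [norm_mul, Complex.norm_real, Real.norm_of_nonneg (Real.rpow_nonneg ht _), Complex.norm_exp]
  simp

theorem differentiableAt_integral_rpow_mul_cexp {s : ℝ} {p : ℂ} (hs : 0 < s) (hp : 0 < p.re) :
    DifferentiableAt ℂ (fun p : ℂ => ∫ t in Set.Ioi (0 : ℝ),
      ((t ^ (s - 1) : ℝ) : ℂ) * Complex.exp (-(p * t))) p := by
  -- On this half-plane `exp (-(Re p / 2) t)` dominates uniformly in `q`.
  have hball : {q : ℂ | p.re / 2 < q.re} ∈ 𝓝 p :=
    (isOpen_lt continuous_const Complex.continuous_re).mem_nhds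
      (by simp only [Set.mem_ofPred_eq]; linarith)
  refine (hasDerivAt_integral_of_dominated_loc_of_deriv_le (μ := volume.restrict (Set.Ioi 0))
    (F := fun (p : ℂ) (t : ℝ) => ((t ^ (s - 1) : ℝ) : ℂ) * Complex.exp (-(p * t)))
    (F' := fun (p : ℂ) (t : ℝ) => ((t ^ (s - 1) : ℝ) : ℂ) * (Complex.exp (-(p * t)) * (-t)))
    (bound := fun t => t ^ (s + 1 - 1) * Real.exp (-(p.re / 2 * t))) hball ?_
    (integrableOn_rpow_mul_cexp_Ioi hs hp) ?_ ?_
    (integrableOn_rpow_mul_exp_neg_mul_Ioi (by linarith) (by linarith)) ?_).2.differentiableAt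
  · exact Eventually.of_forall fun q => (by fun_prop : Measurable fun t : ℝ =>
      ((t ^ (s - 1) : ℝ) : ℂ) * Complex.exp (-(q * t))).aestronglyMeasurable
  · exact (by fun_prop : Measurable fun t : ℝ =>
      ((t ^ (s - 1) : ℝ) : ℂ) * (Complex.exp (-(p * t)) * (-t))).aestronglyMeasurable
  · filter_upwards [ae_restrict_mem measurableSet_Ioi] with t ht q hq
    have ht : 0 < t := ht
    have hq : p.re / 2 < q.re := hq
    rw [← mul_assoc, norm_mul, norm_rpow_mul_cexp ht.le, norm_neg, Complex.norm_real,
      Real.norm_of_nonneg ht.le, show s + 1 - 1 = s - 1 + 1 by ring, Real.rpow_add_one ht.ne',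
      mul_right_comm]
    gcongr
  · refine Eventually.of_forall fun t q _ => HasDerivAt.const_mul _ ?_
    have h : HasDerivAt (fun q : ℂ => -(q * t)) (-(t : ℂ)) q := by
      simpa using (hasDerivAt_mul_const (x := q) (t : ℂ)).fun_neg
    exact h.cexp

/-- For real `p` this is the Gamma integral. Both sides are analytic in the right half-plane and
agree on reals accumulating at `1`, so the identity theorem applies. -/
theorem integral_rpow_mul_cexp_Ioi {s : ℝ} {p : ℂ} (hs : 0 < s) (hp : 0 < p.re) :
    ∫ t in Set.Ioi (0 : ℝ), ((t ^ (s - 1) : ℝ) : ℂ) * Complex.exp (-(p * t)) =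
      p ^ (-s : ℂ) * (Real.Gamma s : ℂ) := by
  set U : Set ℂ := {p | 0 < p.re} with hU
  have hUo : IsOpen U := isOpen_lt continuous_const Complex.continuous_re
  have hUc : IsPreconnected U := (convex_halfSpace_re_gt 0).isPreconnected
  have h1 : AnalyticOnNhd ℂ (fun p : ℂ => ∫ t in Set.Ioi (0 : ℝ),
      ((t ^ (s - 1) : ℝ) : ℂ) * Complex.exp (-(p * t))) U :=
    DifferentiableOn.analyticOnNhd
      (fun q hq => (differentiableAt_integral_rpow_mul_cexp hs hq).differentiableWithinAt) hUo
  have h2 : AnalyticOnNhd ℂ (fun p : ℂ => p ^ (-s : ℂ) * (Real.Gamma s : ℂ)) U := by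
    refine DifferentiableOn.analyticOnNhd (fun q hq => ?_) hUo
    have hq' : q ∈ Complex.slitPlane := Or.inl hq
    exact ((differentiableAt_id.cpow_const hq').mul_const _).differentiableWithinAt
  refine h1.eqOn_of_preconnected_of_frequently_eq h2 hUc (z₀ := 1) (by simp [hU]) ?_ hp
  have ht : Tendsto (fun x : ℝ => (x : ℂ)) (𝓝[>] 1) (𝓝[≠] 1) := by
    refine tendsto_nhdsWithin_iff.2 ⟨?_, ?_⟩
    · exact (Complex.continuous_ofReal.tendsto' 1 1 (by simp)).mono_left nhdsWithin_le_nhds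
    · filter_upwards [self_mem_nhdsWithin] with x hx
      have : x ≠ 1 := ne_of_gt hx
      simpa using this
  refine ht.frequently (Eventually.frequently ?_)
  filter_upwards [self_mem_nhdsWithin] with x hx
  have hx0 : 0 < x := zero_lt_one.trans hx
  have h := Real.integral_rpow_mul_exp_neg_mul_Ioi hs hx0
  have h3 : ∫ t in Set.Ioi (0 : ℝ), ((t ^ (s - 1) : ℝ) : ℂ) * Complex.exp (-(x * t)) =
      ∫ t in Set.Ioi (0 : ℝ), ((t ^ (s - 1) * Real.exp (-(x * t)) : ℝ) : ℂ) := by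
    push_cast
    rfl
  rw [h3, integral_complex_ofReal, h, one_div, Real.inv_rpow hx0.le, ← Real.rpow_neg hx0.le,
    Complex.ofReal_mul, Complex.ofReal_cpow hx0.le]
  push_cast
  rfl

/-- Termwise integration gives `p⁻¹ ∑ (l / p^α)^k`. The bound on `‖l‖` makes the series of `L¹`
norms geometric with ratio below `1`, which justifies the interchange. -/
theorem laplace_mittagLeffler {α : ℝ} (hα : 0 < α) {l p : ℂ} (hp : 0 < p.re)
    (hl : ‖l‖ < p.re ^ α) :
    IntegrableOn (fun t : ℝ => mittagLeffler α (l * ((t ^ α : ℝ) : ℂ)) * Complex.exp (-(p * t)))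
      (Set.Ioi 0) ∧
    ∫ t in Set.Ioi (0 : ℝ), mittagLeffler α (l * ((t ^ α : ℝ) : ℂ)) * Complex.exp (-(p * t)) =
      p ^ (α - 1 : ℂ) / (p ^ (α : ℂ) - l) := by
  have hs (k : ℕ) : 0 < α * k + 1 := by positivity
  have hΓ (k : ℕ) : 0 < Real.Gamma (α * k + 1) := Real.Gamma_pos_of_pos (hs k)
  have hp0 : p ≠ 0 := by
    rintro rfl
    simp at hp
  let F : ℕ → ℝ → ℂ := fun k t => l ^ k / (Real.Gamma (α * k + 1) : ℂ) *
    (((t ^ (α * k + 1 - 1) : ℝ) : ℂ) * Complex.exp (-(p * t)))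
  have hF (k : ℕ) : Integrable (F k) (volume.restrict (Set.Ioi 0)) :=
    (integrableOn_rpow_mul_cexp_Ioi (hs k) hp).const_mul _
  have hnorm (k : ℕ) : ∫ t in Set.Ioi (0 : ℝ), ‖F k t‖ = (1 / p.re) * (‖l‖ / p.re ^ α) ^ k := by
    have : ∫ t in Set.Ioi (0 : ℝ), ‖F k t‖ = ∫ t in Set.Ioi (0 : ℝ),
        ‖l‖ ^ k / Real.Gamma (α * k + 1) * (t ^ (α * k + 1 - 1) * Real.exp (-(p.re * t))) := by
      refine setIntegral_congr_fun measurableSet_Ioi fun t ht => ?_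
      simp only [F]
      rw [norm_mul, norm_rpow_mul_cexp (le_of_lt ht), norm_mittagLeffler_term hα]
    rw [this, integral_const_mul, Real.integral_rpow_mul_exp_neg_mul_Ioi (hs k) hp,
      Real.rpow_add_one (by positivity), Real.rpow_mul (by positivity), Real.rpow_natCast,
      one_div, Real.inv_rpow hp.le]
    have := (hΓ k).ne'
    field_simp
    rw [← mul_pow, mul_one_div]
  have hratio : ‖l‖ / p.re ^ α < 1 := (div_lt_one (by positivity)).2 hl
  have hsum : Summable fun k => ∫ t in Set.Ioi (0 : ℝ), ‖F k t‖ := by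
    simp_rw [hnorm]
    exact (summable_geometric_of_lt_one (by positivity) hratio).mul_left _
  have heq : Set.EqOn (fun t : ℝ => ∑' k, F k t) (fun t : ℝ =>
      mittagLeffler α (l * ((t ^ α : ℝ) : ℂ)) * Complex.exp (-(p * t))) (Set.Ioi 0) := by
    intro t ht
    have h := (hasSum_mittagLeffler_rpow hα (le_of_lt ht) 1 l).mul_right (Complex.exp (-(p * t)))
    simp only [one_mul] at h
    simp only
    rw [← h.tsum_eq]
    refine tsum_congr fun k => ?_
    simp only [F, add_sub_cancel_right]
    push_cast
    ring
  constructor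
  · exact IntegrableOn.congr_fun (integrable_tsum_of_summable_integral_norm hF hsum) heq
      measurableSet_Ioi
  · rw [← setIntegral_congr_fun measurableSet_Ioi heq,
      ← (hasSum_integral_of_summable_integral_norm hF hsum).tsum_eq]
    have hnα : ‖p ^ (α : ℂ)‖ = ‖p‖ ^ α := Complex.norm_cpow_real _ _
    have hlp : ‖l / p ^ (α : ℂ)‖ < 1 := by
      rw [norm_div, hnα]
      refine lt_of_le_of_lt ?_ hratio
      have : p.re ≤ ‖p‖ := Complex.re_le_norm p
      gcongr
    have hpα : p ^ (α : ℂ) ≠ 0 := by simp [Complex.cpow_eq_zero_iff, hp0]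
    have hterm (k : ℕ) : ∫ t in Set.Ioi (0 : ℝ), F k t = p⁻¹ * (l / p ^ (α : ℂ)) ^ k := by
      simp only [F]
      rw [integral_const_mul, integral_rpow_mul_cexp_Ioi (hs k) hp]
      have h1 : p ^ (-((α * k + 1 : ℝ) : ℂ)) = p⁻¹ * (p ^ (α : ℂ))⁻¹ ^ k := by
        push_cast
        rw [Complex.cpow_neg, Complex.cpow_add _ _ hp0, Complex.cpow_one, Complex.cpow_mul_nat,
          mul_inv, inv_pow, mul_comm]
      rw [h1]
      have : (Real.Gamma (α * k + 1) : ℂ) ≠ 0 := by exact_mod_cast (hΓ k).ne'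
      field_simp
      rw [← mul_pow, mul_one_div]
    simp_rw [hterm]
    rw [tsum_mul_left, tsum_geometric_of_norm_lt_one hlp, Complex.cpow_sub _ _ hp0,
      Complex.cpow_one]
    have h1 : p ^ (α : ℂ) - l ≠ 0 := by
      intro h
      rw [sub_eq_zero] at h
      rw [h, div_self (h ▸ hpα)] at hlp
      simp at hlp
    have h2 : 1 - l / p ^ (α : ℂ) = (p ^ (α : ℂ) - l) / p ^ (α : ℂ) := by
      field_simp
    rw [h2, inv_div]
    field_simp

/-! ### The regularised Laplace transform -/

/-- In the closed right half-plane `|arg| ≤ π/2`, so `α · log p` stays in the principal strip and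
`log (p ^ α) = α log p`. -/
theorem eq_of_cpow_eq_cpow {α : ℝ} (hα₀ : 0 < α) (hα₁ : α < 1) {p q : ℂ} (hp : 0 ≤ p.re)
    (hp0 : p ≠ 0) (hq : 0 ≤ q.re) (hq0 : q ≠ 0) (h : p ^ (α : ℂ) = q ^ (α : ℂ)) : p = q := by
  have hlog {z : ℂ} (hz : 0 ≤ z.re) (hz0 : z ≠ 0) :
      Complex.log (z ^ (α : ℂ)) = Complex.log z * α := by
    have harg := abs_le.1 (Complex.abs_arg_le_pi_div_two_iff.2 hz)
    have hpi := Real.pi_pos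
    have him : (Complex.log z * α).im = Complex.arg z * α := by simp [Complex.log_im]
    rw [Complex.cpow_def_of_ne_zero hz0, Complex.log_exp] <;> rw [him] <;> nlinarith [harg.1, harg.2]
  have h1 := congrArg Complex.log h
  rw [hlog hp hp0, hlog hq hq0] at h1
  have h2 := mul_right_cancel₀ (by exact_mod_cast hα₀.ne') h1
  rw [← Complex.exp_log hp0, h2, Complex.exp_log hq0]

/-- `p ^ (α - 1) / (p ^ α - I ^ α)` multiplied by `p - I`, extended analytically to `p = I`. -/
noncomputable def laplaceNumerator (α : ℝ) (p : ℂ) : ℂ :=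
  p ^ (α - 1 : ℂ) / dslope (fun z : ℂ => z ^ (α : ℂ)) Complex.I p

/-- The analytic extension to `p = I` of
`p ^ (α - 1) / (p ^ α - I ^ α) - (1 / α) / (p - I) - (1 - 1 / α) / (p + 1)`. -/
noncomputable def laplaceKernel (α : ℝ) (p : ℂ) : ℂ :=
  dslope (laplaceNumerator α) Complex.I p - (1 - 1 / α) / (p + 1)

section

variable {α : ℝ}

theorem I_mem_slitPlane : Complex.I ∈ Complex.slitPlane := Or.inr (by simp)

theorem mem_slitPlane_of_re_nonneg {p : ℂ} (hp : 0 ≤ p.re) (hp0 : p ≠ 0) :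
    p ∈ Complex.slitPlane := by
  rcases hp.lt_or_eq with h | h
  · exact Or.inl h
  · exact Or.inr fun him => hp0 (Complex.ext h.symm him)

theorem dslope_cpow_I : dslope (fun z : ℂ => z ^ (α : ℂ)) Complex.I Complex.I =
    α * Complex.I ^ (α - 1 : ℂ) := by
  rw [dslope_same]
  have h := (hasDerivAt_id Complex.I).cpow_const (c := (α : ℂ)) I_mem_slitPlane
  simpa using h.deriv

theorem dslope_cpow_of_ne {p : ℂ} (h : p ≠ Complex.I) :
    dslope (fun z : ℂ => z ^ (α : ℂ)) Complex.I p =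
      (p ^ (α : ℂ) - Complex.I ^ (α : ℂ)) / (p - Complex.I) := by
  rw [dslope_of_ne _ h, slope_def_field]

theorem I_cpow_ne_zero (c : ℂ) : Complex.I ^ c ≠ 0 := by
  simp [Complex.cpow_eq_zero_iff]

/-- Injectivity of the power away from `I`, and its nonzero derivative at `I`: the transform has one
pole, and it is simple. -/
theorem dslope_cpow_ne_zero (hα₀ : 0 < α) (hα₁ : α < 1) {p : ℂ} (hp : 0 ≤ p.re) (hp0 : p ≠ 0) :
    dslope (fun z : ℂ => z ^ (α : ℂ)) Complex.I p ≠ 0 := by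
  by_cases h : p = Complex.I
  · rw [h, dslope_cpow_I]
    exact mul_ne_zero (by exact_mod_cast hα₀.ne') (I_cpow_ne_zero _)
  · rw [dslope_cpow_of_ne h]
    refine div_ne_zero (sub_ne_zero.2 fun h' => h ?_) (sub_ne_zero.2 h)
    exact eq_of_cpow_eq_cpow hα₀ hα₁ hp hp0 (by simp) Complex.I_ne_zero h'

/-- The residue at the pole, which is the source of the factor `1/α` in the limit radius. -/
theorem laplaceNumerator_I (hα₀ : 0 < α) : laplaceNumerator α Complex.I = 1 / α := by
  rw [laplaceNumerator, dslope_cpow_I]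
  have := I_cpow_ne_zero (α - 1 : ℂ)
  have : (α : ℂ) ≠ 0 := by exact_mod_cast hα₀.ne'
  field_simp

theorem laplaceKernel_of_ne (hα₀ : 0 < α) {p : ℂ} (h : p ≠ Complex.I) :
    laplaceKernel α p = p ^ (α - 1 : ℂ) / (p ^ (α : ℂ) - Complex.I ^ (α : ℂ)) -
      1 / α / (p - Complex.I) - (1 - 1 / α) / (p + 1) := by
  rw [laplaceKernel, dslope_of_ne _ h, slope_def_field, laplaceNumerator_I hα₀, laplaceNumerator,
    dslope_cpow_of_ne h]
  have := sub_ne_zero.2 h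
  congr 1
  rw [sub_div, div_div_eq_mul_div, div_div, mul_div_mul_right _ _ this]

theorem differentiableAt_laplaceKernel (hα₀ : 0 < α) (hα₁ : α < 1) {p : ℂ} (hp : 0 ≤ p.re)
    (hp0 : p ≠ 0) : DifferentiableAt ℂ (laplaceKernel α) p := by
  set d : ℂ → ℂ := dslope (fun z : ℂ => z ^ (α : ℂ)) Complex.I with hd
  have hslit (q : ℂ) (hq : q ∈ Complex.slitPlane) (c : ℂ) :
      DifferentiableAt ℂ (fun z : ℂ => z ^ c) q := differentiableAt_id.cpow_const hq
  have hdd : DifferentiableOn ℂ d Complex.slitPlane := by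
    rw [hd, Complex.differentiableOn_dslope
      (Complex.isOpen_slitPlane.mem_nhds I_mem_slitPlane)]
    exact fun q hq => (hslit q hq _).differentiableWithinAt
  -- An open set containing the punctured closed half-plane, so that differentiability reaches the
  -- imaginary axis.
  set U : Set ℂ := Complex.slitPlane ∩ d ⁻¹' {0}ᶜ with hU
  have hUo : IsOpen U :=
    hdd.continuousOn.isOpen_inter_preimage Complex.isOpen_slitPlane isOpen_compl_singleton
  have hmem {q : ℂ} (hq : 0 ≤ q.re) (hq0 : q ≠ 0) : q ∈ U :=
    ⟨mem_slitPlane_of_re_nonneg hq hq0, dslope_cpow_ne_zero hα₀ hα₁ hq hq0⟩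
  have hN : DifferentiableOn ℂ (laplaceNumerator α) U := fun q hq =>
    ((hslit q hq.1 _).differentiableWithinAt).div ((hdd q hq.1).mono Set.inter_subset_left) hq.2
  have hN' : DifferentiableOn ℂ (dslope (laplaceNumerator α) Complex.I) U :=
    (Complex.differentiableOn_dslope (hUo.mem_nhds (hmem (by simp) Complex.I_ne_zero))).2 hN
  refine (hN'.differentiableAt (hUo.mem_nhds (hmem hp hp0))).sub ?_
  refine (differentiableAt_const _).div (differentiableAt_id.add_const _) fun h => ?_
  have := congrArg Complex.re h
  simp at this
  linarith

/-- The decay profile of `laplaceKernel α`. -/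
noncomputable def kernelBound (α r : ℝ) : ℝ := min (r ^ (α - 1)) (r ^ (-1 - α))

theorem kernelBound_nonneg {r : ℝ} (hr : 0 ≤ r) : 0 ≤ kernelBound α r :=
  le_min (Real.rpow_nonneg hr _) (Real.rpow_nonneg hr _)

theorem kernelBound_anti (hα₀ : 0 < α) (hα₁ : α < 1) {r s : ℝ} (hr : 0 < r) (h : r ≤ s) :
    kernelBound α s ≤ kernelBound α r :=
  min_le_min (Real.rpow_le_rpow_of_nonpos hr h (by linarith))
    (Real.rpow_le_rpow_of_nonpos hr h (by linarith))

theorem kernelBound_of_le_one (hα₀ : 0 < α) {r : ℝ} (hr : 0 < r) (h : r ≤ 1) :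
    kernelBound α r = r ^ (α - 1) :=
  min_eq_left (Real.rpow_le_rpow_of_exponent_ge hr h (by linarith))

theorem kernelBound_of_one_le (hα₀ : 0 < α) {r : ℝ} (h : 1 ≤ r) :
    kernelBound α r = r ^ (-1 - α) :=
  min_eq_right (Real.rpow_le_rpow_of_exponent_le h (by linarith))

/-- Positivity of `α` serves both ends: `α - 1 > -1` at `0` and `-1 - α < -1` at infinity. -/
theorem integrable_kernelBound (hα₀ : 0 < α) : Integrable fun x : ℝ => kernelBound α |x| := by
  have hmeas : Measurable fun x : ℝ => kernelBound α |x| := by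
    unfold kernelBound
    fun_prop
  have h1 : IntegrableOn (fun x : ℝ => kernelBound α |x|) (Set.Ioc 0 1) := by
    have : IntervalIntegrable (fun x : ℝ => x ^ (α - 1)) volume 0 1 :=
      intervalIntegral.intervalIntegrable_rpow' (by linarith)
    rw [intervalIntegrable_iff_integrableOn_Ioc_of_le zero_le_one] at this
    refine this.congr_fun (fun x hx => ?_) measurableSet_Ioc
    rw [abs_of_pos hx.1, kernelBound_of_le_one hα₀ hx.1 hx.2]
  have h2 : IntegrableOn (fun x : ℝ => kernelBound α |x|) (Set.Ioi 1) := by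
    have : IntegrableOn (fun x : ℝ => x ^ (-1 - α)) (Set.Ioi 1) :=
      integrableOn_Ioi_rpow_of_lt (by linarith) one_pos
    refine this.congr_fun (fun x hx => ?_) measurableSet_Ioi
    have hx : 1 < x := hx
    rw [abs_of_pos (by linarith), kernelBound_of_one_le hα₀ hx.le]
  have h3 : IntegrableOn (fun x : ℝ => kernelBound α |x|) (Set.Ioi 0) := by
    rw [← Set.Ioc_union_Ioi_eq_Ioi zero_le_one]
    exact h1.union h2
  have h4 : IntegrableOn (fun x : ℝ => kernelBound α |x|) (Set.Iic 0) := by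
    rw [integrableOn_Iic_iff_integrableOn_Iio]
    rw [← neg_zero] at h3
    simpa only [abs_neg] using h3.comp_neg_Iio
  rw [← integrableOn_univ, ← Set.Iic_union_Ioi (a := (0 : ℝ))]
  exact h4.union h3

theorem norm_I_cpow : ‖Complex.I ^ (α : ℂ)‖ = 1 := by
  rw [Complex.norm_cpow_real, Complex.norm_I, Real.one_rpow]

/-- Here `|p^α| ≤ 2^(-α) < 1 = |I^α|`, so the denominator is at least `δ`. The two other terms are
bounded and are absorbed because `‖p‖ ^ (α - 1) ≥ 1`. -/
theorem norm_laplaceKernel_le_of_small (hα₀ : 0 < α) (hα₁ : α < 1) :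
    ∃ C, ∀ p : ℂ, p ≠ 0 → ‖p‖ ≤ 1 / 2 → ‖laplaceKernel α p‖ ≤ C * ‖p‖ ^ (α - 1) := by
  set δ : ℝ := 1 - (1 / 2) ^ α with hδ
  have hδ0 : 0 < δ := sub_pos.2 (Real.rpow_lt_one (by norm_num) (by norm_num) hα₀)
  refine ⟨1 / δ + ‖(1 / α : ℂ)‖ / (1 / 2) + ‖(1 - 1 / α : ℂ)‖ / (1 / 2), fun p hp0 hp => ?_⟩
  have hpI : p ≠ Complex.I := by
    rintro rfl
    norm_num at hp
  have hnp : 0 < ‖p‖ := norm_pos_iff.2 hp0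
  have h1 : 1 ≤ ‖p‖ ^ (α - 1) := Real.one_le_rpow_of_pos_of_le_one_of_nonpos hnp (by linarith)
    (by linarith)
  have hd1 : δ ≤ ‖p ^ (α : ℂ) - Complex.I ^ (α : ℂ)‖ := by
    have := norm_sub_norm_le (Complex.I ^ (α : ℂ)) (p ^ (α : ℂ))
    rw [norm_sub_rev, norm_I_cpow, Complex.norm_cpow_real] at this
    have h2 : ‖p‖ ^ α ≤ (1 / 2) ^ α := Real.rpow_le_rpow hnp.le hp hα₀.le
    linarith
  have hd2 : 1 / 2 ≤ ‖p - Complex.I‖ := by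
    have := norm_sub_norm_le Complex.I p
    rw [norm_sub_rev, Complex.norm_I] at this
    linarith
  have hd3 : 1 / 2 ≤ ‖p + 1‖ := by
    have := norm_sub_norm_le 1 (-p)
    rw [norm_neg, norm_one, sub_neg_eq_add, add_comm] at this
    linarith
  have hnum : ‖p ^ (α - 1 : ℂ)‖ = ‖p‖ ^ (α - 1) := by
    have := Complex.norm_cpow_real p (α - 1)
    push_cast at this
    exact this
  rw [laplaceKernel_of_ne hα₀ hpI]
  have e1 : ‖p ^ (α - 1 : ℂ) / (p ^ (α : ℂ) - Complex.I ^ (α : ℂ))‖ ≤ 1 / δ * ‖p‖ ^ (α - 1) := by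
    rw [norm_div, hnum, one_div_mul_eq_div]
    gcongr
  have e2 : ‖1 / (α : ℂ) / (p - Complex.I)‖ ≤ ‖(1 / α : ℂ)‖ / (1 / 2) * ‖p‖ ^ (α - 1) := by
    rw [norm_div]
    calc _ ≤ ‖(1 / α : ℂ)‖ / (1 / 2) := by gcongr
      _ ≤ _ := le_mul_of_one_le_right (by positivity) h1
  have e3 : ‖(1 - 1 / (α : ℂ)) / (p + 1)‖ ≤ ‖(1 - 1 / α : ℂ)‖ / (1 / 2) * ‖p‖ ^ (α - 1) := by
    rw [norm_div]
    calc _ ≤ ‖(1 - 1 / α : ℂ)‖ / (1 / 2) := by gcongr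
      _ ≤ _ := le_mul_of_one_le_right (by positivity) h1
  rw [add_mul, add_mul]
  exact (norm_sub_le _ _).trans (add_le_add ((norm_sub_le _ _).trans (add_le_add e1 e2)) e3)

theorem norm_laplaceKernel_le_of_large (hα₀ : 0 < α) (hα₁ : α < 1) :
    ∃ C, ∀ p : ℂ, 2 ≤ ‖p‖ → ‖laplaceKernel α p‖ ≤ C * ‖p‖ ^ (-1 - α) := by
  set δ : ℝ := 1 - (1 / 2) ^ α with hδ
  have hδ0 : 0 < δ := sub_pos.2 (Real.rpow_lt_one (by norm_num) (by norm_num) hα₀)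
  refine ⟨1 / δ + ‖(1 / α : ℂ)‖ * 2 + ‖(1 - 1 / α : ℂ)‖ * 2, fun p hp => ?_⟩
  have hnp : 0 < ‖p‖ := by linarith
  have hp0 : p ≠ 0 := norm_pos_iff.1 hnp
  have hpI : p ≠ Complex.I := by
    rintro rfl
    norm_num at hp
  have hnα : 0 < ‖p‖ ^ α := by positivity
  have hd1 : δ * ‖p‖ ^ α ≤ ‖p ^ (α : ℂ) - Complex.I ^ (α : ℂ)‖ := by
    have := norm_sub_norm_le (p ^ (α : ℂ)) (Complex.I ^ (α : ℂ))
    rw [norm_I_cpow, Complex.norm_cpow_real] at this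
    have h2 : 1 ≤ (1 / 2) ^ α * ‖p‖ ^ α := by
      rw [← Real.mul_rpow (by norm_num) hnp.le]
      exact Real.one_le_rpow (by linarith) hα₀.le
    rw [hδ]
    linarith
  have hd2 : ‖p‖ / 2 ≤ ‖p - Complex.I‖ := by
    have := norm_sub_norm_le p Complex.I
    rw [Complex.norm_I] at this
    linarith
  have hd3 : ‖p‖ / 2 ≤ ‖p + 1‖ := by
    have := norm_sub_norm_le p (-1)
    rw [norm_neg, norm_one, sub_neg_eq_add] at this
    linarith
  have hr1 : ‖p‖ ^ (-1 - α) = 1 / (‖p‖ * ‖p‖ ^ α) := by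
    rw [sub_eq_add_neg, Real.rpow_add hnp, Real.rpow_neg hnp.le, Real.rpow_neg hnp.le,
      Real.rpow_one, one_div, mul_inv]
  have hr2 : 1 / ‖p‖ ^ 2 ≤ ‖p‖ ^ (-1 - α) := by
    rw [hr1, pow_two]
    have : ‖p‖ ^ α ≤ ‖p‖ := by
      simpa using Real.rpow_le_rpow_of_exponent_le (by linarith : 1 ≤ ‖p‖) hα₁.le
    gcongr
  have hI : p - Complex.I ≠ 0 := sub_ne_zero.2 hpI
  have hd : p ^ (α : ℂ) - Complex.I ^ (α : ℂ) ≠ 0 := by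
    rw [← norm_pos_iff]
    exact (mul_pos hδ0 hnα).trans_le hd1
  have h1 : p + 1 ≠ 0 := by
    rw [← norm_pos_iff]
    linarith
  have hα : (α : ℂ) ≠ 0 := by exact_mod_cast hα₀.ne'
  -- Compare each term with its leading part at infinity: `1/p`, `(1/α)/p` and `(1 - 1/α)/p`. These
  -- cancel, and each difference has an extra factor of decay.
  have hsplit : laplaceKernel α p =
      Complex.I ^ (α : ℂ) / (p * (p ^ (α : ℂ) - Complex.I ^ (α : ℂ))) -
        1 / α * (Complex.I / (p * (p - Complex.I))) + (1 - 1 / α) * (1 / (p * (p + 1))) := by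
    rw [laplaceKernel_of_ne hα₀ hpI, Complex.cpow_sub _ _ hp0, Complex.cpow_one]
    generalize p ^ (α : ℂ) = u at *
    generalize Complex.I ^ (α : ℂ) = v at *
    field_simp
    ring
  have e1 : ‖Complex.I ^ (α : ℂ) / (p * (p ^ (α : ℂ) - Complex.I ^ (α : ℂ)))‖ ≤
      1 / δ * ‖p‖ ^ (-1 - α) := by
    rw [norm_div, norm_I_cpow, norm_mul, hr1, one_div_mul_one_div]
    refine one_div_le_one_div_of_le (by positivity) ?_
    calc δ * (‖p‖ * ‖p‖ ^ α) = ‖p‖ * (δ * ‖p‖ ^ α) := by ring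
      _ ≤ _ := by gcongr
  have e2 : ‖1 / (α : ℂ) * (Complex.I / (p * (p - Complex.I)))‖ ≤
      ‖(1 / α : ℂ)‖ * 2 * ‖p‖ ^ (-1 - α) := by
    rw [norm_mul, norm_div Complex.I, Complex.norm_I, norm_mul p, mul_assoc]
    gcongr
    calc 1 / (‖p‖ * ‖p - Complex.I‖) ≤ 1 / (‖p‖ * (‖p‖ / 2)) := by gcongr
      _ = 2 * (1 / ‖p‖ ^ 2) := by field_simp
      _ ≤ _ := by gcongr
  have e3 : ‖(1 - 1 / (α : ℂ)) * (1 / (p * (p + 1)))‖ ≤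
      ‖(1 - 1 / α : ℂ)‖ * 2 * ‖p‖ ^ (-1 - α) := by
    rw [norm_mul, norm_div, norm_one, norm_mul, mul_assoc]
    gcongr
    calc 1 / (‖p‖ * ‖p + 1‖) ≤ 1 / (‖p‖ * (‖p‖ / 2)) := by gcongr
      _ = 2 * (1 / ‖p‖ ^ 2) := by field_simp
      _ ≤ _ := by gcongr
  rw [hsplit, add_mul, add_mul]
  exact (norm_add_le _ _).trans (add_le_add ((norm_sub_le _ _).trans (add_le_add e1 e2)) e3)

theorem exists_norm_laplaceKernel_le (hα₀ : 0 < α) (hα₁ : α < 1) :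
    ∃ C, 0 ≤ C ∧ ∀ p : ℂ, 0 ≤ p.re → p ≠ 0 → ‖laplaceKernel α p‖ ≤ C * kernelBound α ‖p‖ := by
  obtain ⟨C₁, h₁⟩ := norm_laplaceKernel_le_of_small hα₀ hα₁
  obtain ⟨C₂, h₂⟩ := norm_laplaceKernel_le_of_large hα₀ hα₁
  -- The compact half-annulus between the two regimes, on which continuity gives a bound.
  let K : Set ℂ := Metric.closedBall 0 2 ∩ ({p | 0 ≤ p.re} ∩ {p | 1 / 2 ≤ ‖p‖})
  have hK : IsCompact K := (isCompact_closedBall 0 2).inter_right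
    ((isClosed_le continuous_const Complex.continuous_re).inter
      (isClosed_le continuous_const continuous_norm))
  have hcont : ContinuousOn (laplaceKernel α) K := fun p hp =>
    (differentiableAt_laplaceKernel hα₀ hα₁ hp.2.1 (by
      rintro rfl
      have : (1 : ℝ) / 2 ≤ ‖(0 : ℂ)‖ := hp.2.2
      norm_num at this)).continuousAt.continuousWithinAt
  obtain ⟨C₃, h₃⟩ := hK.exists_bound_of_continuousOn hcont
  have hb2 : 0 < kernelBound α 2 := lt_min (by positivity) (by positivity)
  refine ⟨max 0 (max C₁ (max C₂ (C₃ / kernelBound α 2))), le_max_left _ _, fun p hp hp0 => ?_⟩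
  set C := max 0 (max C₁ (max C₂ (C₃ / kernelBound α 2))) with hC
  have hC1 : C₁ ≤ C := by simp [hC]
  have hC2 : C₂ ≤ C := by simp [hC]
  have hC3 : C₃ / kernelBound α 2 ≤ C := by simp [hC]
  have hnp : 0 < ‖p‖ := norm_pos_iff.2 hp0
  rcases le_total ‖p‖ (1 / 2) with h | h
  · rw [kernelBound_of_le_one hα₀ hnp (by linarith)]
    exact (h₁ p hp0 h).trans (by gcongr)
  · rcases le_total 2 ‖p‖ with h' | h'
    · rw [kernelBound_of_one_le hα₀ (by linarith)]
      exact (h₂ p h').trans (by gcongr)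
    · calc ‖laplaceKernel α p‖ ≤ C₃ := h₃ p ⟨by simpa using h', hp, h⟩
        _ ≤ C * kernelBound α 2 := (div_le_iff₀ hb2).1 hC3
        _ ≤ C * kernelBound α ‖p‖ :=
          mul_le_mul_of_nonneg_left (kernelBound_anti hα₀ hα₁ hnp h') (le_max_left _ _)

end

/-! ### Asymptotics on the boundary of the stability sector -/

theorem ofReal_add_mul_I_re (x y : ℝ) : ((x : ℂ) + y * Complex.I).re = x := by simp

theorem ofReal_add_mul_I_im (x y : ℝ) : ((x : ℂ) + y * Complex.I).im = y := by simp

/-- Cauchy's theorem for two vertical lines in the right half-plane. -/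
theorem integral_vertical_eq {H : ℂ → ℂ} {M : ℝ → ℝ} {ε c : ℝ} (hε : 0 < ε) (hεc : ε ≤ c)
    (hd : ∀ p : ℂ, 0 < p.re → DifferentiableAt ℂ H p) (hM : Integrable M)
    (hM₁ : Tendsto M atTop (𝓝 0)) (hM₂ : Tendsto M atBot (𝓝 0))
    (hb : ∀ p : ℂ, 0 < p.re → p.re ≤ c → p.im ≠ 0 → ‖H p‖ ≤ M p.im) :
    ∫ y : ℝ, H (ε + y * Complex.I) = ∫ y : ℝ, H (c + y * Complex.I) := by
  have hint {x : ℝ} (hx : 0 < x) (hxc : x ≤ c) : Integrable fun y : ℝ => H (x + y * Complex.I) := by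
    refine hM.mono' (Continuous.aestronglyMeasurable ?_) ?_
    · refine continuous_iff_continuousAt.2 fun y => ?_
      exact ContinuousAt.comp (g := H) (hd _ (by simpa using hx)).continuousAt (by fun_prop)
    · filter_upwards [compl_mem_ae_iff.2 (measure_singleton (0 : ℝ))] with y hy
      have := hb (x + y * Complex.I) (by simpa using hx) (by simpa using hxc) (by simpa using hy)
      simpa using this
  have hlim {x : ℝ} (hx : 0 < x) (hxc : x ≤ c) : Tendsto
      (fun R : ℝ => ∫ y in (-R)..R, H (x + y * Complex.I)) atTop
      (𝓝 (∫ y : ℝ, H (x + y * Complex.I))) :=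
    intervalIntegral_tendsto_integral (hint hx hxc) tendsto_neg_atTop_atBot tendsto_id
  -- The horizontal edges of the rectangle have fixed length `c - ε`, so decay of `M` removes them
  -- in the limit.
  have hedge {u : ℝ → ℝ} (hu : ∀ᶠ R in atTop, u R ≠ 0) (hMu : Tendsto (M ∘ u) atTop (𝓝 0)) :
      Tendsto (fun R : ℝ => ∫ x in ε..c, H (x + u R * Complex.I)) atTop (𝓝 0) := by
    have h0 : Tendsto (fun R => M (u R) * |c - ε|) atTop (𝓝 0) := by
      simpa using hMu.mul_const |c - ε|
    refine squeeze_zero_norm' ?_ h0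
    filter_upwards [hu] with R hR
    refine intervalIntegral.norm_integral_le_of_norm_le_const fun x hx => ?_
    rw [Set.uIoc_of_le hεc] at hx
    have := hb (x + u R * Complex.I) (by simpa using hε.trans hx.1) (by simpa using hx.2)
      (by simpa using hR)
    simpa using this
  have hrect (R : ℝ) : (∫ x in ε..c, H (x + (-R : ℝ) * Complex.I)) -
      (∫ x in ε..c, H (x + R * Complex.I)) +
      Complex.I * (∫ y in (-R)..R, H (c + y * Complex.I)) -
      Complex.I * (∫ y in (-R)..R, H (ε + y * Complex.I)) = 0 := by
    have := Complex.integral_boundary_rect_eq_zero_of_differentiableOn H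
      (ε + (-R : ℝ) * Complex.I) (c + R * Complex.I) (fun p hp => by
        refine (hd p ?_).differentiableWithinAt
        have h1 := hp.1
        simp only [Set.mem_preimage, ofReal_add_mul_I_re, Set.uIcc_of_le hεc] at h1
        exact hε.trans_le h1.1)
    simpa only [ofReal_add_mul_I_re, ofReal_add_mul_I_im, smul_eq_mul] using this
  have hlimit := (((hedge (u := fun R => -R) (by
      filter_upwards [eventually_gt_atTop 0] with R hR using (neg_neg_of_pos hR).ne)
      (hM₂.comp tendsto_neg_atTop_atBot)).sub
    (hedge (u := fun R => R) (by
      filter_upwards [eventually_gt_atTop 0] with R hR using hR.ne') hM₁)).add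
    ((hlim (hε.trans_le hεc) le_rfl).const_mul Complex.I)).sub
    ((hlim hε hεc).const_mul Complex.I)
  have h0 := tendsto_nhds_unique (hlimit.congr hrect) tendsto_const_nhds
  rw [sub_zero, zero_add, ← mul_sub, mul_eq_zero, or_iff_right Complex.I_ne_zero, sub_eq_zero] at h0
  exact h0.symm

section

variable {α : ℝ}

theorem tendsto_kernelBound (hα₀ : 0 < α) : Tendsto (kernelBound α) atTop (𝓝 0) := by
  have h : Tendsto (fun r : ℝ => r ^ (-(1 + α))) atTop (𝓝 0) :=
    tendsto_rpow_neg_atTop (by linarith)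
  refine h.congr' ?_
  filter_upwards [eventually_ge_atTop 1] with r hr
  rw [kernelBound_of_one_le hα₀ hr]
  ring_nf

/-- The inverse Laplace integral of `laplaceKernel α` may be taken over the imaginary axis. -/
theorem integral_laplaceKernel_imaginary_axis (hα₀ : 0 < α) (hα₁ : α < 1) {c t : ℝ} (hc : 0 < c)
    (ht : 0 ≤ t) :
    ∫ y : ℝ, laplaceKernel α (c + y * Complex.I) * Complex.exp ((c + y * Complex.I) * t) =
      ∫ y : ℝ, laplaceKernel α (y * Complex.I) * Complex.exp (y * Complex.I * t) := by
  obtain ⟨C, hC, hbound⟩ := exists_norm_laplaceKernel_le hα₀ hα₁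
  let H : ℂ → ℂ := fun p => laplaceKernel α p * Complex.exp (p * t)
  -- Since `|Im p| ≤ ‖p‖`, this majorant is uniform in `0 ≤ Re p ≤ c`. It serves both the contour
  -- shift and the dominated convergence as `ε → 0`.
  let M : ℝ → ℝ := fun y => C * kernelBound α |y| * Real.exp (c * t)
  have hd {p : ℂ} (hp : 0 ≤ p.re) (hp0 : p ≠ 0) : DifferentiableAt ℂ H p :=
    (differentiableAt_laplaceKernel hα₀ hα₁ hp hp0).mul (by fun_prop)
  have hM : Integrable M := ((integrable_kernelBound hα₀).const_mul C).mul_const _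
  have hb (p : ℂ) (hp : 0 ≤ p.re) (hpc : p.re ≤ c) (hpi : p.im ≠ 0) : ‖H p‖ ≤ M p.im := by
    have hp0 : p ≠ 0 := by
      rintro rfl
      simp at hpi
    simp only [H, M]
    rw [norm_mul, Complex.norm_exp]
    have h1 : kernelBound α ‖p‖ ≤ kernelBound α |p.im| :=
      kernelBound_anti hα₀ hα₁ (abs_pos.2 hpi) (Complex.abs_im_le_norm p)
    have h2 : (p * t).re ≤ c * t := by
      simpa using mul_le_mul_of_nonneg_right hpc ht
    have h3 := kernelBound_nonneg (α := α) (norm_nonneg p)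
    have h4 := hbound p hp hp0
    calc _ ≤ C * kernelBound α ‖p‖ * Real.exp (c * t) := by gcongr
      _ ≤ _ := by gcongr
  have hlimM {u : Filter ℝ} (hu : Tendsto (fun y : ℝ => |y|) u atTop) : Tendsto M u (𝓝 0) := by
    have := (((tendsto_kernelBound hα₀).comp hu).const_mul C).mul_const (Real.exp (c * t))
    simpa [M] using this
  have hshift {ε : ℝ} (hε : 0 < ε) (hεc : ε ≤ c) :
      ∫ y : ℝ, H (ε + y * Complex.I) = ∫ y : ℝ, H (c + y * Complex.I) :=
    integral_vertical_eq hε hεc (fun p hp => hd hp.le (by rintro rfl; simp at hp)) hM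
      (hlimM tendsto_abs_atTop_atTop) (hlimM tendsto_abs_atBot_atTop)
      fun p hp hpc hpi => hb p hp.le hpc hpi
  have hne : ∀ᵐ y : ℝ, y ≠ 0 := compl_mem_ae_iff.2 (measure_singleton (0 : ℝ))
  have hIoc : ∀ᶠ ε in 𝓝[>] (0 : ℝ), ε ∈ Set.Ioc 0 c := Ioc_mem_nhdsGT hc
  have hlim : Tendsto (fun ε : ℝ => ∫ y : ℝ, H (ε + y * Complex.I)) (𝓝[>] 0)
      (𝓝 (∫ y : ℝ, H (y * Complex.I))) := by
    refine tendsto_integral_filter_of_dominated_convergence M ?_ ?_ hM ?_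
    · filter_upwards [hIoc] with ε hε
      refine Continuous.aestronglyMeasurable (continuous_iff_continuousAt.2 fun y => ?_)
      refine ContinuousAt.comp (g := H) (hd (by simpa using hε.1.le) ?_).continuousAt (by fun_prop)
      intro h
      have := congrArg Complex.re h
      simp at this
      exact hε.1.ne' this
    · filter_upwards [hIoc] with ε hε
      filter_upwards [hne] with y hy
      have := hb (ε + y * Complex.I) (by simpa using hε.1.le) (by simpa using hε.2)
        (by simpa using hy)
      simpa using this
    · filter_upwards [hne] with y hy
      have h1 : ContinuousAt H (y * Complex.I) :=
        (hd (by simp) (by simpa using hy)).continuousAt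
      refine h1.tendsto.comp ?_
      have : Continuous fun ε : ℝ => (ε : ℂ) + y * Complex.I := by fun_prop
      exact (this.tendsto' 0 _ (by simp)).mono_left nhdsWithin_le_nhds
  refine tendsto_nhds_unique (tendsto_const_nhds.congr' ?_) hlim
  filter_upwards [hIoc] with ε hε using (hshift hε.1 hε.2).symm

/-- `E_α((i t) ^ α)` minus its oscillating part and a correction that makes the value at `0`
vanish. -/
noncomputable def mittagLefflerRemainder (α t : ℝ) : ℂ :=
  mittagLeffler α (Complex.I ^ (α : ℂ) * ((t ^ α : ℝ) : ℂ)) -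
    1 / α * Complex.exp (Complex.I * t) - (1 - 1 / α) * Complex.exp (-t)

theorem continuous_mittagLefflerRemainder (hα₀ : 0 < α) :
    Continuous (mittagLefflerRemainder α) := by
  have h1 : Continuous fun t : ℝ => t ^ α := Real.continuous_rpow_const hα₀.le
  have h2 := (continuous_mittagLeffler hα₀).comp
    ((Complex.continuous_ofReal.comp h1).const_mul (Complex.I ^ (α : ℂ)))
  exact (h2.sub (by fun_prop)).sub (by fun_prop)

/-- `Re p > 1` gives `‖I^α‖ = 1 < (Re p)^α`, the convergence condition for the Mittag-Leffler
transform. -/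
theorem laplace_mittagLefflerRemainder (hα₀ : 0 < α) {p : ℂ} (hp : 1 < p.re) :
    IntegrableOn (fun t : ℝ => mittagLefflerRemainder α t * Complex.exp (-(p * t))) (Set.Ioi 0) ∧
    ∫ t in Set.Ioi (0 : ℝ), mittagLefflerRemainder α t * Complex.exp (-(p * t)) =
      laplaceKernel α p := by
  have hexp {q : ℂ} (hq : q.re < 1) : IntegrableOn
      (fun t : ℝ => Complex.exp ((q - p) * t)) (Set.Ioi 0) ∧
      ∫ t in Set.Ioi (0 : ℝ), Complex.exp ((q - p) * t) = 1 / (p - q) := by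
    have hre : (q - p).re < 0 := by
      rw [Complex.sub_re]
      linarith
    refine ⟨integrableOn_exp_mul_complex_Ioi hre 0, ?_⟩
    rw [integral_exp_mul_complex_Ioi hre, Complex.ofReal_zero, mul_zero, Complex.exp_zero,
      ← neg_sub p q, neg_div_neg_eq]
  have h1 := laplace_mittagLeffler hα₀ (l := Complex.I ^ (α : ℂ)) (by linarith : 0 < p.re)
    (by rw [norm_I_cpow]; exact Real.one_lt_rpow hp hα₀)
  have h2 := hexp (q := Complex.I) (by simp)
  have h3 := hexp (q := -1) (by simp)
  have heq (t : ℝ) : mittagLefflerRemainder α t * Complex.exp (-(p * t)) =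
      mittagLeffler α (Complex.I ^ (α : ℂ) * ((t ^ α : ℝ) : ℂ)) * Complex.exp (-(p * t)) -
        1 / α * Complex.exp ((Complex.I - p) * t) -
        (1 - 1 / α) * Complex.exp ((-1 - p) * t) := by
    rw [mittagLefflerRemainder, sub_mul (Complex.I), sub_mul (-1 : ℂ), sub_eq_add_neg (Complex.I * _),
      sub_eq_add_neg (-1 * _), Complex.exp_add, Complex.exp_add, neg_one_mul]
    ring
  simp_rw [heq]
  have i1 : IntegrableOn (fun t : ℝ =>
      mittagLeffler α (Complex.I ^ (α : ℂ) * ((t ^ α : ℝ) : ℂ)) * Complex.exp (-(p * t)) -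
        1 / α * Complex.exp ((Complex.I - p) * t)) (Set.Ioi 0) :=
    h1.1.sub (h2.1.const_mul (1 / (α : ℂ)))
  have i2 := h3.1.const_mul (1 - 1 / (α : ℂ))
  refine ⟨i1.sub i2, ?_⟩
  have hpI : p ≠ Complex.I := by
    rintro rfl
    norm_num at hp
  rw [integral_sub i1 i2, integral_sub h1.1 (h2.1.const_mul _), h1.2, integral_const_mul,
    integral_const_mul, h2.2, h3.2, laplaceKernel_of_ne hα₀ hpI, sub_neg_eq_add, mul_one_div,
    mul_one_div]

/-- The Laplace transform on `Re p = 2` is a Fourier transform of the remainder times `e^{-2s}`.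
Fourier inversion at the continuity point `t` is followed by the shift to the imaginary axis. -/
theorem mittagLefflerRemainder_eq_integral (hα₀ : 0 < α) (hα₁ : α < 1) {t : ℝ} (ht : 0 < t) :
    mittagLefflerRemainder α t = (1 / (2 * Real.pi) : ℝ) •
      ∫ y : ℝ, laplaceKernel α (y * Complex.I) * Complex.exp (y * Complex.I * t) := by
  let f : ℝ → ℂ := (Set.Ioi 0).indicator
    fun s : ℝ => mittagLefflerRemainder α s * Complex.exp (-(2 * s))
  have hline (w : ℝ) : (1 : ℝ) < ((2 : ℂ) + (2 * Real.pi * w : ℝ) * Complex.I).re := by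
    have := ofReal_add_mul_I_re 2 (2 * Real.pi * w)
    push_cast at this ⊢
    rw [this]
    norm_num
  have hf : Integrable f := by
    rw [integrable_indicator_iff measurableSet_Ioi]
    exact (laplace_mittagLefflerRemainder hα₀ (p := 2) (by norm_num)).1
  have hFf (w : ℝ) : FourierTransform.fourier f w =
      laplaceKernel α ((2 : ℂ) + (2 * Real.pi * w : ℝ) * Complex.I) := by
    rw [← (laplace_mittagLefflerRemainder hα₀ (hline w)).2, Real.fourier_eq',
      ← integral_indicator measurableSet_Ioi]
    refine integral_congr_ae (Eventually.of_forall fun s => ?_)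
    simp only [f, Set.indicator_apply]
    split_ifs
    · rw [smul_eq_mul, mul_left_comm, ← Complex.exp_add]
      congr 2
      simp
      ring
    · simp
  obtain ⟨C, hC, hbound⟩ := exists_norm_laplaceKernel_le hα₀ hα₁
  have hcont : Continuous fun y : ℝ => laplaceKernel α ((2 : ℂ) + (y : ℝ) * Complex.I) := by
    refine continuous_iff_continuousAt.2 fun y => ?_
    refine ContinuousAt.comp (g := laplaceKernel α)
      (differentiableAt_laplaceKernel hα₀ hα₁ (by simp) ?_).continuousAt (by fun_prop)
    intro h
    have := congrArg Complex.re h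
    simp at this
  have hint : Integrable fun y : ℝ => laplaceKernel α ((2 : ℂ) + (y : ℝ) * Complex.I) := by
    refine ((integrable_kernelBound hα₀).const_mul C).mono' hcont.aestronglyMeasurable ?_
    filter_upwards [compl_mem_ae_iff.2 (measure_singleton (0 : ℝ))] with y hy
    have hy : y ≠ 0 := hy
    have hp0 : (2 : ℂ) + (y : ℝ) * Complex.I ≠ 0 := fun h => by
      have := congrArg Complex.re h
      simp at this
    refine (hbound _ (by simp) hp0).trans (mul_le_mul_of_nonneg_left ?_ hC)
    refine kernelBound_anti hα₀ hα₁ (abs_pos.2 hy) ?_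
    simpa using Complex.abs_im_le_norm ((2 : ℂ) + (y : ℝ) * Complex.I)
  have hpi : 2 * Real.pi ≠ 0 := by positivity
  have hFint : Integrable (FourierTransform.fourier f) := by
    rw [show FourierTransform.fourier f = _ from funext hFf]
    exact hint.comp_mul_left' hpi
  have hcontAt : ContinuousAt f t := by
    have hc : Continuous fun s : ℝ => mittagLefflerRemainder α s * Complex.exp (-(2 * s)) :=
      (continuous_mittagLefflerRemainder hα₀).mul (by fun_prop)
    refine hc.continuousAt.congr ?_
    filter_upwards [Ioi_mem_nhds ht] with s hs
    simp only [f]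
    rw [Set.indicator_of_mem hs]
  have hinv := hf.fourierInv_fourier_eq hFint hcontAt
  rw [Real.fourierInv_eq'] at hinv
  have hft : f t = mittagLefflerRemainder α t * Complex.exp (-(2 * t)) :=
    Set.indicator_of_mem (show t ∈ Set.Ioi (0 : ℝ) from ht) _
  rw [hft] at hinv
  -- The substitution `y = 2π w` undoes the `2π` in the exponent of the Fourier transform and
  -- produces the factor `1 / (2π)`.
  have hscale := Measure.integral_comp_mul_left (fun y : ℝ =>
    Complex.exp (y * Complex.I * t) * laplaceKernel α ((2 : ℂ) + (y : ℝ) * Complex.I)) (2 * Real.pi)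
  have h1 : ∫ v : ℝ, Complex.exp (((2 * Real.pi * inner ℝ v t : ℝ) : ℂ) * Complex.I) •
      FourierTransform.fourier f v = ∫ x : ℝ,
      Complex.exp ((2 * Real.pi * x : ℝ) * Complex.I * t) *
        laplaceKernel α ((2 : ℂ) + (2 * Real.pi * x : ℝ) * Complex.I) := by
    refine integral_congr_ae (Eventually.of_forall fun v => ?_)
    simp only
    rw [hFf, smul_eq_mul]
    congr 2
    simp
    ring
  rw [h1, hscale] at hinv
  have h2 := integral_laplaceKernel_imaginary_axis hα₀ hα₁ two_pos ht.le
  have h3 : mittagLefflerRemainder α t =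
      mittagLefflerRemainder α t * Complex.exp (-(2 * t)) * Complex.exp (2 * t) := by
    rw [mul_assoc, ← Complex.exp_add]
    simp
  rw [h3, ← hinv, ← h2, smul_mul_assoc, ← integral_mul_const,
    abs_of_pos (by positivity), one_div]
  congr 2
  ext y
  rw [add_mul, Complex.exp_add]
  push_cast
  ring

/-- Riemann-Lebesgue for the integral over the imaginary axis, at frequency `-t / (2π)`. -/
theorem tendsto_mittagLefflerRemainder (hα₀ : 0 < α) (hα₁ : α < 1) :
    Tendsto (mittagLefflerRemainder α) atTop (𝓝 0) := by
  have hRL := Real.tendsto_integral_exp_smul_cocompact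
    fun y : ℝ => laplaceKernel α (y * Complex.I)
  have hpi := Real.pi_pos
  have hscale : Tendsto (fun t : ℝ => -(t / (2 * Real.pi))) atTop (cocompact ℝ) :=
    (tendsto_neg_atTop_atBot.comp (tendsto_id.atTop_div_const (by positivity))).mono_right
      atBot_le_cocompact
  have h := (hRL.comp hscale).const_smul (1 / (2 * Real.pi) : ℝ)
  rw [smul_zero] at h
  refine h.congr' ?_
  filter_upwards [eventually_gt_atTop 0] with t ht
  rw [mittagLefflerRemainder_eq_integral hα₀ hα₁ ht]
  simp only [Function.comp_apply]
  congr 2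
  ext y
  rw [Circle.smul_def, Real.fourierChar_apply, smul_eq_mul, mul_comm]
  congr 2
  push_cast
  have : (Real.pi : ℂ) ≠ 0 := by exact_mod_cast hpi.ne'
  field_simp

theorem tendsto_norm_mittagLeffler (hα₀ : 0 < α) (hα₁ : α < 1) :
    Tendsto (fun t : ℝ => ‖mittagLeffler α (Complex.I ^ (α : ℂ) * ((t ^ α : ℝ) : ℂ))‖) atTop
      (𝓝 (1 / α)) := by
  have hexp : Tendsto (fun t : ℝ => (1 - 1 / α : ℂ) * Complex.exp (-t)) atTop (𝓝 0) := by
    have : Tendsto (fun t : ℝ => Complex.exp (-t)) atTop (𝓝 0) := by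
      rw [Complex.tendsto_exp_nhds_zero_iff]
      simpa using tendsto_neg_atTop_atBot
    simpa using this.const_mul (1 - 1 / α : ℂ)
  have h := ((tendsto_mittagLefflerRemainder hα₀ hα₁).add hexp).norm
  rw [add_zero, norm_zero] at h
  rw [tendsto_iff_norm_sub_tendsto_zero]
  refine squeeze_zero (fun _ => norm_nonneg _) (fun t => ?_) h
  have hn : ‖1 / (α : ℂ) * Complex.exp (Complex.I * t)‖ = 1 / α := by
    rw [norm_mul, mul_comm Complex.I, Complex.norm_exp_ofReal_mul_I, mul_one, norm_div, norm_one,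
      Complex.norm_real, Real.norm_of_nonneg hα₀.le]
  rw [mittagLefflerRemainder, sub_add_cancel, ← hn, Real.norm_eq_abs]
  exact abs_norm_sub_norm_le _ _

end

/-! ### The main theorem -/

theorem I_cpow_eq_exp (α : ℝ) :
    Complex.I ^ (α : ℂ) = Complex.exp (Complex.I * (α * Real.pi / 2)) := by
  rw [Complex.cpow_def_of_ne_zero Complex.I_ne_zero, Complex.log_I]
  congr 1
  ring

/-- Since `r t^α = (r^(1/α) t)^α`, the modulus `r` is only a change of time scale. -/
theorem tendsto_norm_mittagLeffler_mul {α r : ℝ} (hα₀ : 0 < α) (hα₁ : α < 1) (hr : 0 < r) :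
    Tendsto (fun t : ℝ => ‖mittagLeffler α
      ((r : ℂ) * Complex.exp (Complex.I * (α * Real.pi / 2)) * ((t ^ α : ℝ) : ℂ))‖) atTop
      (𝓝 (1 / α)) := by
  have hscale : Tendsto (fun t : ℝ => r ^ α⁻¹ * t) atTop atTop :=
    tendsto_id.const_mul_atTop (by positivity)
  refine ((tendsto_norm_mittagLeffler hα₀ hα₁).comp hscale).congr' ?_
  filter_upwards [eventually_ge_atTop 0] with t ht
  simp only [Function.comp_apply]
  rw [Real.mul_rpow (by positivity) ht, ← Real.rpow_mul hr.le, inv_mul_cancel₀ hα₀.ne',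
    Real.rpow_one, I_cpow_eq_exp]
  congr 2
  push_cast
  ring

theorem mem_spectrum_canonical (a b : ℝ) :
    (⟨a, b⟩ : ℂ) ∈ spectrum ℂ ((!![a, b; -b, a] : Matrix (Fin 2) (Fin 2) ℝ).map
      (algebraMap ℝ ℂ)) := by
  rw [spectrum.mem_iff, Matrix.isUnit_iff_isUnit_det, isUnit_iff_ne_zero, not_not,
    Matrix.det_fin_two]
  apply Complex.ext <;>
    simp [Matrix.algebraMap_eq_diagonal, Complex.mul_re, Complex.mul_im]

/-- Which eigenvalue equals `a + ib` is not determined by the spectrum, but conjugation leaves the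
modulus of `E_α` unchanged. -/
theorem norm_mittagLeffler_canonical {α r a b : ℝ}
    (h : (⟨a, b⟩ : ℂ) ∈ ({(r : ℂ) * Complex.exp (Complex.I * (α * Real.pi / 2)),
      (r : ℂ) * Complex.exp (-(Complex.I * (α * Real.pi / 2)))} : Set ℂ)) (x : ℝ) :
    ‖mittagLeffler α ((⟨a, -b⟩ : ℂ) * (x : ℂ))‖ =
      ‖mittagLeffler α ((r : ℂ) * Complex.exp (Complex.I * (α * Real.pi / 2)) * (x : ℂ))‖ := by
  have hconj : (⟨a, -b⟩ : ℂ) = starRingEnd ℂ ⟨a, b⟩ := rfl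
  have hexp : starRingEnd ℂ (Complex.exp (-(Complex.I * (α * Real.pi / 2)))) =
      Complex.exp (Complex.I * (α * Real.pi / 2)) := by
    rw [← Complex.exp_conj]
    simp [map_ofNat]
  rcases h with h | h
  · have : (⟨a, -b⟩ : ℂ) * (x : ℂ) = starRingEnd ℂ
        ((r : ℂ) * Complex.exp (Complex.I * (α * Real.pi / 2)) * (x : ℂ)) := by
      rw [hconj, h, map_mul, map_mul, map_mul, Complex.conj_ofReal, Complex.conj_ofReal]
    rw [this, mittagLeffler_conj, RCLike.norm_conj]
  · rw [hconj, Set.mem_singleton_iff.1 h, map_mul, hexp, Complex.conj_ofReal]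

/-- Radial projection onto the sphere; from the centre any point of the sphere will do. -/
theorem infDist_sphere_zero_le {E : Type*} [NormedAddCommGroup E] [NormedSpace ℝ E] [Nontrivial E]
    (x : E) {R : ℝ} (hR : 0 ≤ R) :
    Metric.infDist x (Metric.sphere (0 : E) R) ≤ |‖x‖ - R| := by
  by_cases hx : x = 0
  · obtain ⟨y, hy⟩ := NormedSpace.sphere_nonempty (x := (0 : E)).2 hR
    refine (Metric.infDist_le_dist_of_mem hy).trans_eq ?_
    rw [hx, dist_comm, Metric.mem_sphere.1 hy, norm_zero, zero_sub, abs_neg, abs_of_nonneg hR]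
  · have hn : ‖x‖ ≠ 0 := norm_ne_zero_iff.2 hx
    have hmem : (R / ‖x‖) • x ∈ Metric.sphere (0 : E) R := by
      rw [mem_sphere_zero_iff_norm, norm_smul, norm_div, norm_norm, Real.norm_of_nonneg hR,
        div_mul_cancel₀ _ hn]
    refine (Metric.infDist_le_dist_of_mem hmem).trans_eq ?_
    have : x - (R / ‖x‖) • x = ((‖x‖ - R) / ‖x‖) • x := by
      rw [sub_div, div_self hn, sub_smul, one_smul]
    rw [dist_eq_norm, this, norm_smul, norm_div, norm_norm, div_mul_cancel₀ _ hn, Real.norm_eq_abs]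

theorem theorem4p1 (α r a b C₁ C₂ : ℝ) (hα₀ : 0 < α) (hα₁ : α < 1) (hr : 0 < r)
    (A : Matrix (Fin 2) (Fin 2) ℝ) (hA : A = !![a, b; -b, a])
    (hspec : spectrum ℂ (A.map (algebraMap ℝ ℂ)) =
      {(r : ℂ) * Complex.exp (Complex.I * (α * Real.pi / 2)),
        (r : ℂ) * Complex.exp (-(Complex.I * (α * Real.pi / 2)))}) :
    (∃ X : ℝ → EuclideanSpace ℝ (Fin 2), IsCaputoSolution α A !₂[C₁, C₂] X ∧
      ∀ t : ℝ, 0 < t → ∀ i, caputoDeriv α (fun s => X s i) t = A.mulVec (fun j => X t j) i) ∧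
    ∀ X : ℝ → EuclideanSpace ℝ (Fin 2), IsCaputoSolution α A !₂[C₁, C₂] X →
      (∀ t : ℝ, 0 ≤ t → X t 0 ^ 2 + X t 1 ^ 2 =
        (C₁ ^ 2 + C₂ ^ 2) *
          ‖mittagLeffler α ((r : ℂ) * Complex.exp (Complex.I * (α * Real.pi / 2)) *
            ((t ^ α : ℝ) : ℂ))‖ ^ 2) ∧
      Tendsto (fun t : ℝ => X t 0 ^ 2 + X t 1 ^ 2) atTop
        (𝓝 ((C₁ ^ 2 + C₂ ^ 2) / α ^ 2)) ∧
      Tendsto (fun t : ℝ => Metric.infDist (X t)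
        (Metric.sphere (0 : EuclideanSpace ℝ (Fin 2)) (√(C₁ ^ 2 + C₂ ^ 2) / α))) atTop (𝓝 0) := by
  subst hA
  refine ⟨⟨_, isCaputoSolution_planarSolution hα₀ hα₁,
    fun t ht i => caputoDeriv_planarSolution hα₀ hα₁ _ ht i⟩, fun X hX => ?_⟩
  have hab := hspec ▸ mem_spectrum_canonical a b
  have hsq : ∀ t : ℝ, 0 ≤ t → X t 0 ^ 2 + X t 1 ^ 2 = (C₁ ^ 2 + C₂ ^ 2) *
      ‖mittagLeffler α ((r : ℂ) * Complex.exp (Complex.I * (α * Real.pi / 2)) *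
        ((t ^ α : ℝ) : ℂ))‖ ^ 2 := by
    intro t ht
    obtain ⟨h0, h1⟩ := planarSolution_apply hα₀ ht ⟨C₁, C₂⟩ ⟨a, -b⟩
    rw [hX.eq_of_planar hα₀ hα₁ (isCaputoSolution_planarSolution hα₀ hα₁) ht, h0, h1,
      ← norm_mittagLeffler_canonical hab, pow_two (Complex.re _), pow_two (Complex.im _),
      ← Complex.normSq_apply, Complex.normSq_eq_norm_sq, norm_mul, mul_pow,
      ← Complex.normSq_eq_norm_sq ⟨C₁, C₂⟩, Complex.normSq_mk, ← pow_two, ← pow_two]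
  have hlim : Tendsto (fun t : ℝ => X t 0 ^ 2 + X t 1 ^ 2) atTop
      (𝓝 ((C₁ ^ 2 + C₂ ^ 2) / α ^ 2)) := by
    have h := ((tendsto_norm_mittagLeffler_mul hα₀ hα₁ hr).pow 2).const_mul (C₁ ^ 2 + C₂ ^ 2)
    rw [one_div, inv_pow, ← div_eq_mul_inv] at h
    refine h.congr' ?_
    filter_upwards [eventually_ge_atTop 0] with t ht using (hsq t ht).symm
  refine ⟨hsq, hlim, ?_⟩
  have hnorm : Tendsto (fun t => ‖X t‖) atTop (𝓝 (√(C₁ ^ 2 + C₂ ^ 2) / α)) := by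
    have h := hlim.sqrt
    rw [Real.sqrt_div' _ (by positivity), Real.sqrt_sq hα₀.le] at h
    refine h.congr fun t => ?_
    rw [EuclideanSpace.norm_eq, Fin.sum_univ_two, Real.norm_eq_abs, Real.norm_eq_abs, sq_abs,
      sq_abs]
  have habs := (hnorm.sub_const (√(C₁ ^ 2 + C₂ ^ 2) / α)).abs
  rw [sub_self, abs_zero] at habs
  exact squeeze_zero (fun _ => Metric.infDist_nonneg)
    (fun t => infDist_sphere_zero_le (X t) (by positivity)) habs
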